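/- All rings are commutative, noetherian and non-zero. For a local ring $R$, an $R$-complex is a $\mathbb Z$-graded complex of $R$-modules, and it is homologically bounded if its homology vanishes in all but finitely many degrees. A dualizing complex for $R$ is a homologically bounded $R$-complex $D$ with finitely generated homology modules which is isomorphic in the derived category to a bounded complex of injective modules and for which the homothety morphism $R\to \mathbf R\mathrm{Hom}_R(D,D)$ is an isomorphism. Given a dualizing complex $D$ for $R$, the Auslander class $\mathcal A(R)$ consists of the homologically bounded $R$-complexes $X$ such that $D\otimes^{\mathbf L}_R X$ is homologically bounded and the canonical morphism $X\to \mathbf R\mathrm{Hom}_R(D, D\otimes^{\mathbf L}_R X)$ is an isomorphism in the derived category; the Bass class $\mathcal B(R)$ consists of the homologically bounded $R$-complexes $Y$ such that $\mathbf R\mathrm{Hom}_R(D,Y)$ is homologically bounded and the canonical morphism $D\otimes^{\mathbf L}_R\mathbf R\mathrm{Hom}_R(D,Y)\to Y$ is an isomorphism in the derived category. **Proposition.** Let $\varphi:(R,\mathfrak m)\to(S,\mathfrak n)$ be a finite local homomorphism of local rings such that $S$ has finite flat dimension over $R$, and let $D$ be a dualizing complex for $R$. Then the $S$-complex $\tilde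 D=\mathbf R\mathrm{Hom}_R(S,D)$ is a dualizing complex for $S$ and, with $\mathcal A(R),\mathcal B(R)$ formed with respect to $D$ and $\mathcal A(S),\mathcal B(S)$ formed with respect to $\tilde D$, the following hold for every homologically bounded $R$-complex $X$: (i) if $X\in\mathcal A(R)$, then $S\otimes^{\mathbf L}_R X\in\mathcal A(S)$; (ii) if $X\in\mathcal B(R)$, then $\mathbf R\mathrm{Hom}_R(S,X)\in\mathcal B(S)$. -/

import Mathlib

universe u

namespace AuslanderBass

open scoped TensorProduct
open CategoryTheory CochainComplex.HomComplex

noncomputable section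

/-- `R`-complexes, graded cohomologically: the module `X_ℓ` in homological degree `ℓ`
is `X.X (-ℓ)`. -/
abbrev Cplx (R : Type u) [CommRing R] : Type (u + 1) := CochainComplex (ModuleCat.{u} R) ℤ

section Complexes

variable {R : Type u} [CommRing R]

/-- `X ≃ Y`: the complexes are linked by quasi-isomorphisms `X ⟵ Z ⟶ Y`
(that is, they are isomorphic in the derived category). -/
def Equivalent (X Y : Cplx R) : Prop :=
  ∃ (Z : Cplx R) (f : Z ⟶ X) (g : Z ⟶ Y), QuasiIso f ∧ QuasiIso g

/-- Homological boundedness: `H(X)` is concentrated in finitely many degrees. -/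
def HomologicallyBounded (X : Cplx R) : Prop :=
  ∃ a b : ℤ, X.IsGE a ∧ X.IsLE b

/-- The complex itself is concentrated in finitely many degrees. -/
def Bounded (X : Cplx R) : Prop :=
  ∃ a b : ℤ, X.IsStrictlyGE a ∧ X.IsStrictlyLE b

/-- Finite injective dimension of a complex. -/
def FiniteInjectiveDimension (X : Cplx R) : Prop :=
  ∃ U : Cplx R, (∀ n, Injective (U.X n)) ∧ Bounded U ∧ Equivalent X U

/-- Finite flat dimension of a complex. -/
def FiniteFlatDimension (X : Cplx R) : Prop :=
  ∃ U : Cplx R, (∀ n, Module.Flat R (U.X n)) ∧ Bounded U ∧ Equivalent X U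

/-- A projective resolution of a complex: a quasi-isomorphism `P ⟶ X` where `P` is a complex of
projective modules which vanishes in large cohomological (small homological) degrees. -/
structure ProjRes (X : Cplx R) where
  P : Cplx R
  π : P ⟶ X
  projective : ∀ n, Projective (P.X n)
  bounded : ∃ b : ℤ, P.IsStrictlyLE b
  quasiIso : QuasiIso π

/-- An injective resolution of a complex: a quasi-isomorphism `X ⟶ I` where `I` is a complex of
injective modules which vanishes in small cohomological (large homological) degrees. -/
structure InjRes (X : Cplx R) where
  I : Cplx R
  ι : X ⟶ I
  injective : ∀ n, Injective (I.X n)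
  bounded : ∃ a : ℤ, I.IsStrictlyGE a
  quasiIso : QuasiIso ι

theorem HomologicallyBounded.nonempty_injRes {X : Cplx R} (hX : HomologicallyBounded X) :
    Nonempty (InjRes X) := by
  obtain ⟨a, b, ha, hb⟩ := hX
  obtain ⟨L, i, hi, hL, hs⟩ :=
    CochainComplex.Plus.modelCategoryQuillen.exists_quasiIso_injective (X.truncGE a) a
  exact ⟨⟨L, X.πTruncGE a ≫ i, hL, ⟨a, hs⟩, inferInstance⟩⟩

theorem exists_projective_quasiIso (X : Cplx R) (b : ℤ) [X.IsStrictlyLE b] :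
    ∃ (P : Cplx R) (π : P ⟶ X), (∀ n, Projective (P.X n)) ∧ P.IsStrictlyLE b ∧
      QuasiIso π := by
  let e := CochainComplex.opEquivalence (ModuleCat.{u} R)
  have hK : (e.functor.obj (Opposite.op X)).IsStrictlyGE (-b) := by
    rw [CochainComplex.isStrictlyGE_iff]
    intro i hi
    exact (X.isZero_of_isStrictlyLE b (-i) (by lia)).op
  obtain ⟨L, i, hi, hL, hs⟩ :=
    CochainComplex.Plus.modelCategoryQuillen.exists_quasiIso_injective
      (e.functor.obj (Opposite.op X)) (-b)
  have hq : QuasiIso (e.inverse.map i).unop := by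
    rw [quasiIso_iff]
    intro n
    rw [quasiIsoAt_iff' _ (n - 1) n (n + 1) (by simp) (by simp)]
    have h := (quasiIsoAt_iff' i (-(n + 1)) (-n) (-(n - 1)) (by simp; lia) (by simp; lia)).1
      inferInstance
    exact ShortComplex.quasiIso_unopMap
      ((HomologicalComplex.shortComplexFunctor' _ _ (-(n + 1)) (-n) (-(n - 1))).map i)
  refine ⟨(e.inverse.obj L).unop, (e.inverse.map i).unop ≫ (e.unitIso.hom.app (Opposite.op X)).unop,
    fun n ↦ ?_, ?_, ?_⟩
  · have := hL (-n)
    exact inferInstanceAs (Projective (Opposite.unop (L.X (-n))))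
  · rw [CochainComplex.isStrictlyLE_iff]
    intro n hn
    exact (L.isZero_of_isStrictlyGE (-b) (-n) (by lia)).unop
  · infer_instance

theorem HomologicallyBounded.nonempty_projRes {X : Cplx R} (hX : HomologicallyBounded X) :
    Nonempty (ProjRes X) := by
  obtain ⟨a, b, ha, hb⟩ := hX
  obtain ⟨P, π, hP, hs, hπ⟩ := exists_projective_quasiIso (X.truncLE b) b
  exact ⟨⟨P, π ≫ X.ιTruncLE b, hP, ⟨b, hs⟩, inferInstance⟩⟩

theorem map_units_smul {M N : ModuleCat.{u} R} (e : ℤˣ) (f : M ⟶ N) (x : M) :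
    f (e • x) = e • f x := by
  obtain rfl | rfl := Int.units_eq_one_or e
  · simp
  · simp

/-- The Hom complex `Hom_R(X, Y)` as a complex of `R`-modules: in degree `n` it is
`∏ p, Hom_R(X^p, Y^(p+n))`, with `δ z = d ∘ z - (-1)^n z ∘ d`. -/
def homComplex (X Y : Cplx R) : Cplx R where
  X n := ModuleCat.of R (CochainComplex.HomComplex.Cochain X Y n)
  d i j := ModuleCat.ofHom (CochainComplex.HomComplex.δ_hom R X Y i j)
  shape i j h := by
    refine ModuleCat.hom_ext (LinearMap.ext fun z ↦ ?_)
    exact CochainComplex.HomComplex.δ_shape i j h z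
  d_comp_d' i j k _ _ := by
    refine ModuleCat.hom_ext (LinearMap.ext fun z ↦ ?_)
    exact CochainComplex.HomComplex.δ_δ i j k z

/-- The tensor product complex `X ⊗_R Y`, with `d (x ⊗ y) = d x ⊗ y + (-1)^|x| x ⊗ d y`. -/
abbrev tensorComplex (X Y : Cplx R) : Cplx R := HomologicalComplex.tensorObj X Y

/-- The inclusion of `X^p ⊗_R Y^n` into the tensor product complex, as a bilinear map. -/
def tmul (X Y : Cplx R) (p n q : ℤ) (h : p + n = q) :
    X.X p →ₗ[R] Y.X n →ₗ[R] (tensorComplex X Y).X q :=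
  (TensorProduct.mk R (X.X p) (Y.X n)).compr₂
    (HomologicalComplex.ιTensorObj X Y p n q h).hom

theorem units_smul_apply {M N : ModuleCat.{u} R} (e : ℤˣ) (f : M ⟶ N) (x : M) :
    (e • f) x = e • f x := by
  obtain rfl | rfl := Int.units_eq_one_or e
  · simp
  · simp

theorem tmul_d (X Y : Cplx R) (p n q p' n' q' : ℤ) (h : p + n = q) (hp : p + 1 = p')
    (hn : n + 1 = n') (h₁ : p' + n = q') (h₂ : p + n' = q') (x : X.X p) (y : Y.X n) :
    (tensorComplex X Y).d q q' (tmul X Y p n q h x y) =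
      tmul X Y p' n q' h₁ (X.d p p' x) y + p.negOnePow • tmul X Y p n' q' h₂ x (Y.d n n' y) := by
  have e : HomologicalComplex.ιTensorObj X Y p n q h ≫ (tensorComplex X Y).d q q' =
      MonoidalCategory.whiskerRight (X.d p p') (Y.X n) ≫
        HomologicalComplex.ιTensorObj X Y p' n q' h₁ +
      p.negOnePow • (MonoidalCategory.whiskerLeft (X.X p) (Y.d n n') ≫
        HomologicalComplex.ιTensorObj X Y p n' q' h₂) := by
    rw [HomologicalComplex.mapBifunctor.d_eq, Preadditive.comp_add,
      HomologicalComplex.mapBifunctor.ι_D₁, HomologicalComplex.mapBifunctor.ι_D₂,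
      HomologicalComplex.mapBifunctor.d₁_eq _ _ _ _ (show (ComplexShape.up ℤ).Rel p p' from hp)
        _ _ h₁,
      HomologicalComplex.mapBifunctor.d₂_eq _ _ _ _ _
        (show (ComplexShape.up ℤ).Rel n n' from hn) _ h₂]
    congr 1
    exact one_smul _ _
  have e' := LinearMap.congr_fun (congrArg ModuleCat.Hom.hom e) (x ⊗ₜ[R] y)
  refine e'.trans ?_
  exact congrArg (fun t ↦ tmul X Y p' n q' h₁ (X.d p p' x) y + t) (units_smul_apply _ _ _)

theorem tensorComplex_hom_ext {X Y : Cplx R} {q : ℤ} {M : ModuleCat.{u} R}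
    {f g : (tensorComplex X Y).X q ⟶ M}
    (H : ∀ (p n : ℤ) (h : p + n = q) (x : X.X p) (y : Y.X n),
      f (tmul X Y p n q h x y) = g (tmul X Y p n q h x y)) : f = g := by
  refine HomologicalComplex.mapBifunctor.hom_ext fun p n h ↦ ?_
  refine ModuleCat.hom_ext (TensorProduct.ext' fun x y ↦ ?_)
  exact H p n h x y

/-- The canonical morphism `X ⟶ Hom(P, P ⊗ X)` in degree `n`. -/
def unitCochain (P X : Cplx R) (n : ℤ) :
    X.X n →ₗ[R] Cochain P (tensorComplex P X) n where
  toFun x := Cochain.mk fun p q h ↦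
    (p * n).negOnePow • ModuleCat.ofHom ((tmul P X p n q h).flip x)
  map_add' x y := by
    ext p q h : 1
    rw [Cochain.add_v, Cochain.mk_v, Cochain.mk_v, Cochain.mk_v, map_add, ModuleCat.ofHom_add,
      smul_add]
  map_smul' r x := by
    ext p q h : 1
    rw [RingHom.id_apply, Cochain.smul_v, Cochain.mk_v, Cochain.mk_v, map_smul, smul_comm]
    rfl

/-- The canonical morphism `X ⟶ Hom(P, P ⊗ X)`, `x ↦ (y ↦ (-1)^(|y||x|) y ⊗ x)`. -/
def toHomTensor (P X : Cplx R) : X ⟶ homComplex P (tensorComplex P X) where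
  f n := ModuleCat.ofHom (unitCochain P X n)
  comm' i j hij := by
    have hij : i + 1 = j := hij
    refine ModuleCat.hom_ext (LinearMap.ext fun x ↦ ?_)
    change δ i j (unitCochain P X i x) = unitCochain P X j (X.d i j x)
    ext p q h : 1
    rw [δ_v i j hij _ p q h (q - 1) (p + 1) rfl rfl]
    refine ModuleCat.hom_ext (LinearMap.ext fun y ↦ ?_)
    change (tensorComplex P X).d (q - 1) q (((p * i).negOnePow • ModuleCat.ofHom
        ((tmul P X p i (q - 1) (by lia)).flip x)) y) +
      (j.negOnePow • (P.d p (p + 1) ≫ (((p + 1) * i).negOnePow • ModuleCat.ofHom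
        ((tmul P X (p + 1) i q (by lia)).flip x)))) y =
      ((p * j).negOnePow • ModuleCat.ofHom ((tmul P X p j q h).flip (X.d i j x))) y
    rw [units_smul_apply, units_smul_apply, units_smul_apply, ModuleCat.comp_apply,
      units_smul_apply]
    change (tensorComplex P X).d (q - 1) q
        ((p * i).negOnePow • tmul P X p i (q - 1) (by lia) y x) +
      j.negOnePow • ((p + 1) * i).negOnePow • tmul P X (p + 1) i q (by lia) (P.d p (p + 1) y) x =
      (p * j).negOnePow • tmul P X p j q h y (X.d i j x)
    rw [map_units_smul, tmul_d P X p i (q - 1) (p + 1) j q (by lia) rfl hij (by lia) h,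
      smul_add, smul_smul, smul_smul, ← Int.negOnePow_add, ← Int.negOnePow_add,
      show j + (p + 1) * i = p * i + 1 + 2 * i by rw [← hij]; ring,
      show p * i + p = p * j by rw [← hij]; ring,
      Int.negOnePow_add, Int.negOnePow_two_mul, mul_one, Int.negOnePow_succ, Units.neg_smul]
    abel

/-- The canonical morphism `P ⊗ Hom(P, Y) ⟶ Y` in degree `q`. -/
def evalAux (P Y : Cplx R) (q : ℤ) : (tensorComplex P (homComplex P Y)).X q ⟶ Y.X q :=
  HomologicalComplex.mapBifunctorDesc fun p n h ↦
    (p * n).negOnePow • ModuleCat.ofHom (TensorProduct.lift (LinearMap.mk₂ R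
      (fun (y : P.X p) (z : Cochain P Y n) ↦ z.v p q h y)
      (fun y y' _ ↦ map_add _ y y') (fun r y _ ↦ map_smul _ r y)
      (fun _ _ _ ↦ rfl) (fun _ _ _ ↦ rfl)))

theorem evalAux_tmul (P Y : Cplx R) (p n q : ℤ) (h : p + n = q) (y : P.X p)
    (z : (homComplex P Y).X n) :
    evalAux P Y q (tmul P (homComplex P Y) p n q h y z) =
      (p * n).negOnePow • Cochain.v (F := P) (G := Y) z p q h y := by
  have e := HomologicalComplex.ι_mapBifunctorDesc (K₁ := P) (K₂ := homComplex P Y)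
    (F := MonoidalCategory.curriedTensor (ModuleCat.{u} R)) (c := ComplexShape.up ℤ)
    (fun (p n : ℤ) (h : p + n = q) ↦
      (p * n).negOnePow • ModuleCat.ofHom (TensorProduct.lift (LinearMap.mk₂ R
      (fun (y : P.X p) (z : Cochain P Y n) ↦ z.v p q h y)
      (fun y y' _ ↦ map_add _ y y') (fun r y _ ↦ map_smul _ r y)
      (fun _ _ _ ↦ rfl) (fun _ _ _ ↦ rfl)))) p n h
  have e' := LinearMap.congr_fun (congrArg ModuleCat.Hom.hom e)
    ((y ⊗ₜ[R] z : P.X p ⊗[R] (homComplex P Y).X n))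
  refine e'.trans ?_
  exact units_smul_apply _ _ _

/-- The canonical morphism `P ⊗ Hom(P, Y) ⟶ Y`, `y ⊗ z ↦ (-1)^(|y||z|) z(y)`. -/
def tensorHomEval (P Y : Cplx R) : tensorComplex P (homComplex P Y) ⟶ Y where
  f q := evalAux P Y q
  comm' i j hij := by
    have hij : i + 1 = j := hij
    refine tensorComplex_hom_ext fun p n h y z ↦ ?_
    rw [ModuleCat.comp_apply, ModuleCat.comp_apply, evalAux_tmul,
      tmul_d P (homComplex P Y) p n i (p + 1) (n + 1) j h rfl rfl (by lia) (by lia), map_add,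
      map_units_smul, map_units_smul, evalAux_tmul, evalAux_tmul]
    change (p * n).negOnePow • Y.d i j (Cochain.v z p i h y) =
      ((p + 1) * n).negOnePow • Cochain.v z (p + 1) j (by lia) (P.d p (p + 1) y) +
      p.negOnePow • (p * (n + 1)).negOnePow • Cochain.v (δ n (n + 1) z) p j (by lia) y
    have e : Cochain.v (δ n (n + 1) z) p j (by lia) y =
        Y.d i j (Cochain.v z p i h y) +
          (n + 1).negOnePow • Cochain.v z (p + 1) j (by lia) (P.d p (p + 1) y) := by
      rw [δ_v n (n + 1) rfl z p j (by lia) i (p + 1) (by lia) rfl]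
      exact congrArg (fun t ↦ Y.d i j (Cochain.v z p i h y) + t) (units_smul_apply _ _ _)
    rw [e, smul_add, smul_add, smul_smul, smul_smul, smul_smul, ← Int.negOnePow_add,
      ← Int.negOnePow_add,
      show p + p * (n + 1) = p * n + 2 * p by ring,
      show p * n + 2 * p + (n + 1) = (p + 1) * n + 1 + 2 * p by ring,
      Int.negOnePow_add _ (2 * p), Int.negOnePow_add _ (2 * p), Int.negOnePow_two_mul, mul_one,
      mul_one, Int.negOnePow_succ, Units.neg_smul]
    abel

/-- The homothety morphism `R ⟶ Hom(P, D)`, `r ↦ r π`, attached to `π : P ⟶ D`. -/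
def homothety {P D : Cplx R} (π : P ⟶ D) :
    (HomologicalComplex.single (ModuleCat.{u} R) (ComplexShape.up ℤ) 0).obj (ModuleCat.of R R) ⟶
      homComplex P D :=
  HomologicalComplex.mkHomFromSingle
    (ModuleCat.ofHom (LinearMap.toSpanSingleton R (Cochain P D 0) (Cochain.ofHom π))) (by
      intro j _
      refine ModuleCat.hom_ext (LinearMap.ext fun r ↦ ?_)
      change δ 0 j (r • Cochain.ofHom π) = 0
      rw [δ_smul, δ_ofHom, smul_zero])

namespace ProjRes

variable {D : Cplx R} (r : ProjRes D)

/-- `D ⊗ᴸ_R X`, computed with the projective resolution `r` of `D`. -/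
abbrev lTensor (X : Cplx R) : Cplx R := tensorComplex r.P X

/-- `RHom_R(D, Y)`, computed with the projective resolution `r` of `D`. -/
abbrev rHom (Y : Cplx R) : Cplx R := homComplex r.P Y

/-- The canonical morphism `X ⟶ RHom_R(D, D ⊗ᴸ_R X)`. -/
abbrev toRHomLTensor (X : Cplx R) : X ⟶ r.rHom (r.lTensor X) := toHomTensor r.P X

/-- The canonical morphism `D ⊗ᴸ_R RHom_R(D, Y) ⟶ Y`. -/
abbrev lTensorRHomTo (Y : Cplx R) : r.lTensor (r.rHom Y) ⟶ Y := tensorHomEval r.P Y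

end ProjRes

/-- `D` is a dualizing complex for `R`: its homology is bounded and finitely generated, it has
finite injective dimension, and the homothety morphism `R ⟶ RHom_R(D, D)` is an isomorphism in
the derived category. (The choice of the projective resolution of `D` is immaterial.) -/
structure IsDualizing (D : Cplx R) : Prop where
  bounded : HomologicallyBounded D
  finite : ∀ n, Module.Finite R (D.homology n)
  injective : FiniteInjectiveDimension D
  homothety : ∃ r : ProjRes D, QuasiIso (homothety r.π)

/-- The Auslander class of `R` with respect to the dualizing complex `D`. (The choice of the
projective resolution of `D` is immaterial.) -/
def AuslanderClass (D : Cplx R) : ObjectProperty (Cplx R) := fun X ↦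
  HomologicallyBounded X ∧
    ∃ r : ProjRes D, HomologicallyBounded (r.lTensor X) ∧ QuasiIso (r.toRHomLTensor X)

/-- The Bass class of `R` with respect to the dualizing complex `D`. (The choice of the
projective resolution of `D` is immaterial.) -/
def BassClass (D : Cplx R) : ObjectProperty (Cplx R) := fun Y ↦
  HomologicallyBounded Y ∧
    ∃ r : ProjRes D, HomologicallyBounded (r.rHom Y) ∧ QuasiIso (r.lTensorRHomTo Y)

end Complexes

section ChangeOfRings

variable {R S : Type u} [CommRing R] [CommRing S] (φ : R →+* S)

/-- `S` as an `R`-module via `φ`, viewed as an `R`-complex concentrated in degree `0`. -/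
abbrev targetComplex : Cplx R :=
  (HomologicalComplex.single (ModuleCat.{u} R) (ComplexShape.up ℤ) 0).obj
    ((ModuleCat.restrictScalars φ).obj (ModuleCat.of S S))

instance : (ModuleCat.coextendScalars.{u, u, u} φ).Additive :=
  (ModuleCat.restrictCoextendScalarsAdj φ).right_adjoint_additive

/-- The `S`-complex `S ⊗ᴸ_R X`, that is `S ⊗_R P` for a projective resolution `P ⟶ X`. -/
def lBaseChange (X : Cplx R) (hX : HomologicallyBounded X) : Cplx S :=
  ((ModuleCat.extendScalars.{u, u, u} φ).mapHomologicalComplex (ComplexShape.up ℤ)).obj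
    hX.nonempty_projRes.some.P

/-- The `S`-complex `RHom_R(S, X)`, that is `Hom_R(S, I)` for an injective resolution
`X ⟶ I`. -/
def rCobaseChange (X : Cplx R) (hX : HomologicallyBounded X) : Cplx S :=
  ((ModuleCat.coextendScalars.{u, u, u} φ).mapHomologicalComplex (ComplexShape.up ℤ)).obj
    hX.nonempty_injRes.some.I

end ChangeOfRings

end

end AuslanderBass

/-!
Let `I` be an injective resolution of `D`. A complex `A` lies in the Auslander class, and a complex
`B` in the Bass class, exactly when they are matched by a perfect pairing: a morphism
`u : P ⟶ Hom(I, J)` such that `u` and its transpose `I ⊗ P ⟶ J` are quasi-isomorphisms, where `P` is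
a projective resolution of `A` and `J` an injective resolution of `B`.

A pairing `u` induces `S ⊗ P ⟶ Hom_S(Hom_R(S, I), Hom_R(S, J)) ≅ Hom_R(Hom_R(S, I), J)`, sending
`s ⊗ y` to `f ↦ u(y)(f(s))`. This makes sense, and is natural, with `S` replaced by any module. So
does the dual `Hom(Hom(S, J), K) ⟶ Hom(P, Hom(Hom(S, I), K))` of the induced transpose, for `K` an
injective cogenerator. Over the module `R` both are quasi-isomorphisms if `u` is perfect, hence by
dévissage they are so for finite modules of finite projective dimension. A finite module of finite
flat dimension over a noetherian ring is of this kind, so the induced pairing is perfect; applied to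
the pairing `R ⟶ Hom(I, I)`, the same argument shows that `Hom_R(S, I)` is dualizing.
-/

namespace AuslanderBass

open scoped TensorProduct
open CategoryTheory CochainComplex.HomComplex

noncomputable section

section QuasiIso

variable {R : Type u} [CommRing R]

theorem comm_apply {X Y : Cplx R} (f : X ⟶ Y) (i j : ℤ) (x : X.X i) :
    f.f j (X.d i j x) = Y.d i j (f.f i x) := by
  rw [← ModuleCat.comp_apply, ← ModuleCat.comp_apply, f.comm]

theorem exactAt_iff_apply (X : Cplx R) (i j k : ℤ) (hij : i + 1 = j) (hjk : j + 1 = k) :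
    X.ExactAt j ↔ ∀ x : X.X j, X.d j k x = 0 → ∃ y : X.X i, X.d i j y = x := by
  rw [X.exactAt_iff' i j k (by simp; lia) (by simp; lia), ShortComplex.moduleCat_exact_iff]
  rfl

theorem quasiIso_of_bijective {X Y : Cplx R} (f : X ⟶ Y)
    (hf : ∀ n, Function.Bijective (f.f n)) : QuasiIso f := by
  have (n : ℤ) : IsIso (f.f n) := (ConcreteCategory.isIso_iff_bijective _).2 (hf n)
  have := HomologicalComplex.Hom.isIso_of_components f
  infer_instance

/-- The element `(a, b)` of the mapping cone of `f`, whose degree `i` part is `X^j ⊕ Y^i` with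
`j = i + 1`. -/
def coneMk {X Y : Cplx R} (f : X ⟶ Y) {i j : ℤ} (h : i + 1 = j) (a : X.X j) (b : Y.X i) :
    (CochainComplex.mappingCone f).X i :=
  (CochainComplex.mappingCone.inl f).v j i (by lia) a + (CochainComplex.mappingCone.inr f).f i b

section Cone

variable {X Y : Cplx R} (f : X ⟶ Y) {i j k : ℤ}

theorem coneMk_zero (h : i + 1 = j) : coneMk f h 0 0 = 0 := by
  rw [coneMk, map_zero, map_zero, add_zero]

theorem d_coneMk (hij : i + 1 = j) (hjk : j + 1 = k) (a : X.X j) (b : Y.X i) :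
    (CochainComplex.mappingCone f).d i j (coneMk f hij a b) =
      coneMk f hjk (-X.d j k a) (f.f j a + Y.d i j b) := by
  have h₁ := ConcreteCategory.congr_hom
    (CochainComplex.mappingCone.inl_v_d f j i k (by lia) (by lia)) a
  have h₂ := ConcreteCategory.congr_hom (CochainComplex.mappingCone.inr_f_d f i j) b
  simp only [ModuleCat.comp_apply, ModuleCat.hom_sub, LinearMap.sub_apply] at h₁ h₂
  rw [coneMk, coneMk, map_add, h₁, h₂, map_add, map_neg]
  abel

theorem coneMk_injective (h : i + 1 = j) {a a' : X.X j} {b b' : Y.X i}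
    (hab : coneMk f h a b = coneMk f h a' b') : a = a' ∧ b = b' := by
  have fst_coneMk (a : X.X j) (b : Y.X i) :
      (CochainComplex.mappingCone.fst f).1.v i j h (coneMk f h a b) = a := by
    have e₁ := ConcreteCategory.congr_hom (CochainComplex.mappingCone.inl_v_fst_v f j i h) a
    have e₂ := ConcreteCategory.congr_hom (CochainComplex.mappingCone.inr_f_fst_v f i j h) b
    simp only [ModuleCat.comp_apply, ModuleCat.id_apply] at e₁ e₂
    rw [coneMk, map_add, e₁, e₂]
    exact add_zero a
  have snd_coneMk (a : X.X j) (b : Y.X i) :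
      (CochainComplex.mappingCone.snd f).v i i (add_zero i) (coneMk f h a b) = b := by
    have e₁ := ConcreteCategory.congr_hom
      (CochainComplex.mappingCone.inl_v_snd_v f j i (by lia)) a
    have e₂ := ConcreteCategory.congr_hom (CochainComplex.mappingCone.inr_f_snd_v f i) b
    simp only [ModuleCat.comp_apply, ModuleCat.id_apply] at e₁ e₂
    rw [coneMk, map_add, e₁, e₂]
    exact zero_add b
  exact ⟨by rw [← fst_coneMk a b, hab, fst_coneMk], by rw [← snd_coneMk a b, hab, snd_coneMk]⟩

theorem exists_coneMk_eq (h : i + 1 = j) (c : (CochainComplex.mappingCone f).X i) :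
    ∃ (a : X.X j) (b : Y.X i), coneMk f h a b = c :=
  ⟨_, _, ConcreteCategory.congr_hom (CochainComplex.mappingCone.id_X f i j h) c⟩

/-- Exactness of the mapping cone of `f`, spelled out on elements. -/
def ConeExact {X Y : Cplx R} (f : X ⟶ Y) : Prop :=
  ∀ (i j k l : ℤ), i + 1 = j → j + 1 = k → k + 1 = l → ∀ (x : X.X k) (z : Y.X j),
    X.d k l x = 0 → f.f k x = Y.d j k z →
      ∃ (x' : X.X j) (y' : Y.X i), X.d j k x' = x ∧ f.f j x' + Y.d i j y' = z

theorem acyclic_mappingCone_iff_coneExact :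
    (CochainComplex.mappingCone f).Acyclic ↔ ConeExact f := by
  constructor
  · intro h i j k l hij hjk hkl x z hx hz
    obtain ⟨c, hc⟩ := (exactAt_iff_apply _ i j k hij hjk).1 (h j) (coneMk f hjk (-x) z) (by
      rw [d_coneMk f hjk hkl, map_neg, map_neg, hx, hz, neg_zero, neg_zero, neg_add_cancel,
        coneMk_zero])
    obtain ⟨a, b, rfl⟩ := exists_coneMk_eq f hij c
    rw [d_coneMk f hij hjk] at hc
    obtain ⟨h₁, h₂⟩ := coneMk_injective f hjk hc
    exact ⟨a, b, neg_injective h₁, h₂⟩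
  · intro h j
    refine (exactAt_iff_apply _ (j - 1) j (j + 1) (by lia) rfl).2 fun c hc ↦ ?_
    obtain ⟨a, b, rfl⟩ := exists_coneMk_eq f rfl c
    rw [d_coneMk f rfl rfl, ← coneMk_zero f rfl] at hc
    obtain ⟨h₁, h₂⟩ := coneMk_injective f rfl hc
    obtain ⟨x', y', hx', hy'⟩ := h (j - 1) j (j + 1) (j + 1 + 1) (by lia) rfl rfl (-a) b
      (by rw [map_neg]; exact h₁) (by rw [map_neg, neg_eq_iff_add_eq_zero]; exact h₂)
    exact ⟨coneMk f (by lia) x' y', by rw [d_coneMk f (by lia) rfl, hx', hy', neg_neg]⟩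

theorem quasiIso_iff_acyclic_mappingCone :
    QuasiIso f ↔ (CochainComplex.mappingCone f).Acyclic := by
  rw [← HomotopyCategory.quotient_obj_mem_subcategoryAcyclic_iff_acyclic,
    ← HomologicalComplex.mem_quasiIso_iff, ← HomotopyCategory.quotient_map_mem_quasiIso_iff,
    HomotopyCategory.quasiIso_eq_trW_subcategoryAcyclic]
  exact ObjectProperty.trW_iff_of_distinguished _ _
    (HomotopyCategory.mappingCone_triangleh_distinguished f)

theorem quasiIso_iff_coneExact : QuasiIso f ↔ ConeExact f :=
  (quasiIso_iff_acyclic_mappingCone f).trans (acyclic_mappingCone_iff_coneExact f)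

end Cone

end QuasiIso

section HomComplex

variable {R : Type u} [CommRing R]

/-- Functoriality of the Hom complex in the second variable, by postcomposition. -/
def homComplexMapRight (X : Cplx R) {Y Y' : Cplx R} (g : Y ⟶ Y') :
    homComplex X Y ⟶ homComplex X Y' where
  f n := ModuleCat.ofHom
    { toFun z := Cochain.comp z (Cochain.ofHom g) (add_zero n)
      map_add' z z' := Cochain.add_comp _ _ _ _
      map_smul' r z := Cochain.smul_comp _ _ _ _ }
  comm' i j _ := by
    refine ModuleCat.hom_ext (LinearMap.ext fun z ↦ ?_)
    exact δ_comp_ofHom (n := i) (m := j) z g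

/-- Functoriality of the Hom complex in the first variable, by precomposition. -/
def homComplexMapLeft {X X' : Cplx R} (f : X ⟶ X') (Y : Cplx R) :
    homComplex X' Y ⟶ homComplex X Y where
  f n := ModuleCat.ofHom
    { toFun z := Cochain.comp (Cochain.ofHom f) z (zero_add n)
      map_add' z z' := Cochain.comp_add _ _ _ _
      map_smul' r z := Cochain.comp_smul _ _ _ _ }
  comm' i j _ := by
    refine ModuleCat.hom_ext (LinearMap.ext fun z ↦ ?_)
    exact δ_ofHom_comp f (n := i) (m := j) z

theorem homComplexMapRight_apply (X : Cplx R) {Y Y' : Cplx R} (g : Y ⟶ Y') (n : ℤ)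
    (z : Cochain X Y n) :
    (homComplexMapRight X g).f n z = Cochain.comp z (Cochain.ofHom g) (add_zero n) := rfl

theorem homComplexMapLeft_apply {X X' : Cplx R} (f : X ⟶ X') (Y : Cplx R) (n : ℤ)
    (z : Cochain X' Y n) :
    (homComplexMapLeft f Y).f n z = Cochain.comp (Cochain.ofHom f) z (zero_add n) := rfl

theorem exists_δ_eq_of_isKProjective {K L : Cplx R} {n : ℤ} (z : Cocycle K L n)
    [K.IsKProjective] (hL : L.Acyclic) (m : ℤ) (hm : m + 1 = n) :
    ∃ α : Cochain K L m, δ m n α = z.1 := by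
  obtain ⟨φ, hφ⟩ := (Cocycle.equivHom ..).surjective (z.rightShift n 0 (zero_add n))
  rw [Cocycle.ext_iff] at hφ
  replace hφ : Cochain.ofHom φ = z.1.rightShift n 0 (zero_add n) := hφ
  have hL' : (L⟦n⟧).Acyclic := by
    intro i
    rw [HomologicalComplex.exactAt_iff_isZero_homology]
    exact ((hL (n + i)).isZero_homology).of_iso
      (((HomologicalComplex.homologyFunctor _ _ 0).shiftIso n i (n + i) rfl).app L)
  obtain ⟨h⟩ := CochainComplex.IsKProjective.nonempty_homotopy_zero φ hL'
  obtain ⟨f, hf⟩ := Cochain.equivHomotopy _ _ h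
  simp only [Int.reduceNeg, Cochain.ofHom_zero, add_zero] at hf
  refine ⟨n.negOnePow • Cochain.rightUnshift f m (by lia), ?_⟩
  apply (Cochain.rightShiftAddEquiv _ _ _ n 0 (by simp)).injective
  change Cochain.rightShift (δ m n _) n 0 (zero_add n) = Cochain.rightShift z.1 n 0 (zero_add n)
  rw [← hφ, hf, δ_units_smul, Cochain.rightShift_units_smul,
    Cochain.δ_rightUnshift _ _ _ _ 0 (by simp)]
  simp [smul_smul]

theorem quasiIso_homComplexMapRight (Q : Cplx R) [Q.IsKProjective] {X Y : Cplx R} (f : X ⟶ Y)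
    (hf : QuasiIso f) : QuasiIso (homComplexMapRight Q f) := by
  rw [quasiIso_iff_acyclic_mappingCone] at hf
  rw [quasiIso_iff_coneExact]
  intro i j k l hij hjk hkl (x : Cochain Q X k) (z : Cochain Q Y j) (hx : δ k l x = 0)
    (hz : x.comp (Cochain.ofHom f) (add_zero k) = δ j k z)
  obtain ⟨α, hα⟩ := exists_δ_eq_of_isKProjective
    (CochainComplex.mappingCone.liftCocycle f (Cocycle.mk (-x) l hkl (by simp [hx])) z hjk
      (by simp [← hz])) hf i hij
  have h₁ := congrArg
    (fun c ↦ c.comp (CochainComplex.mappingCone.fst f).1 (show j + 1 = k from hjk)) hα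
  have h₂ := congrArg (fun c ↦ c.comp (CochainComplex.mappingCone.snd f) (add_zero j)) hα
  refine ⟨α.comp (CochainComplex.mappingCone.fst f).1 hij,
    α.comp (CochainComplex.mappingCone.snd f) (add_zero i), ?_, ?_⟩
  · change δ j k _ = x
    rw [δ_comp _ _ hij j 2 k hjk hij rfl, h₁]
    simp [CochainComplex.mappingCone.liftCocycle]
  · change Cochain.comp _ _ (add_zero j) + δ i j _ = z
    rw [δ_comp_zero_cochain _ _ _ hij, h₂]
    simp only [CochainComplex.mappingCone.δ_snd, CochainComplex.mappingCone.liftCocycle,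
      Cocycle.mk_coe, CochainComplex.mappingCone.liftCochain_snd, Cochain.comp_neg,
      Cochain.comp_assoc_of_third_is_zero_cochain]
    exact add_neg_cancel_left _ _

theorem quasiIso_homComplexMapLeft {X Y : Cplx R} (f : X ⟶ Y) (J : Cplx R) [J.IsKInjective]
    (hf : QuasiIso f) : QuasiIso (homComplexMapLeft f J) := by
  rw [quasiIso_iff_acyclic_mappingCone] at hf
  rw [quasiIso_iff_coneExact]
  intro i j k l hij hjk hkl (x : Cochain Y J k) (z : Cochain X J j) (hx : δ k l x = 0)
    (hz : (Cochain.ofHom f).comp x (zero_add k) = δ j k z)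
  obtain ⟨α, hα⟩ := CochainComplex.IsKInjective.eq_δ_of_cocycle
    (CochainComplex.mappingCone.descCocycle f (k.negOnePow • z) (Cocycle.mk x l hkl hx) hjk
      (by simp [hz])) hf j hjk
  have h₁ := congrArg
    (fun c ↦ (CochainComplex.mappingCone.inl f).comp c (show -1 + k = j by lia)) hα
  have h₂ := congrArg
    (fun c ↦ (Cochain.ofHom (CochainComplex.mappingCone.inr f)).comp c (zero_add k)) hα
  refine ⟨(Cochain.ofHom (CochainComplex.mappingCone.inr f)).comp α (zero_add j),
    k.negOnePow • (CochainComplex.mappingCone.inl f).comp α (show -1 + j = i by lia), ?_, ?_⟩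
  · change δ j k _ = x
    simpa using h₂
  · change Cochain.comp _ _ (zero_add j) + δ i j _ = z
    rw [δ_units_smul, δ_comp _ _ (show -1 + j = i by lia) 0 k j hij (by lia) hjk, h₁]
    have hk : k.negOnePow = - j.negOnePow := by rw [← hjk, Int.negOnePow_succ]
    simp only [CochainComplex.mappingCone.descCocycle, Cocycle.mk_coe,
      CochainComplex.mappingCone.inl_descCochain, CochainComplex.mappingCone.δ_inl,
      Cochain.ofHom_comp, Cochain.comp_assoc_of_first_is_zero_cochain, smul_add, smul_smul,
      Int.units_mul_self, one_smul, hk, neg_mul, Units.neg_smul, smul_neg, neg_neg]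
    exact (add_left_comm _ _ _).trans (by rw [add_neg_cancel]; exact add_zero z)

end HomComplex

section CharacterDuality

variable {R : Type u} [CommRing R]

theorem exists_linearMap_characterModule_ne_zero {M : Type u} [AddCommGroup M] [Module R M]
    (N : Submodule R M) {x : M} (hx : x ∉ N) :
    ∃ χ : M →ₗ[R] CharacterModule R, (∀ y ∈ N, χ y = 0) ∧ χ x ≠ 0 := by
  obtain ⟨c, hc⟩ := CharacterModule.exists_character_apply_ne_zero_of_ne_zero
    (A := M ⧸ N) (a := N.mkQ x) (by simpa using hx)
  let ψ : M ⧸ N →ₗ[R] CharacterModule R :=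
    CharacterModule.curry (CharacterModule.congr (TensorProduct.rid R (M ⧸ N)).symm c)
  have hψ (y : M ⧸ N) : ψ y 1 = c y := congrArg c (by simp)
  refine ⟨ψ ∘ₗ N.mkQ, fun y hy ↦ ?_, fun h ↦ hc ?_⟩
  · rw [LinearMap.comp_apply, N.mkQ_apply, (Submodule.Quotient.mk_eq_zero N).2 hy, map_zero]
  · rw [← hψ]
    exact DFunLike.congr_fun h 1

variable (R) in
/-- The injective cogenerator `CharacterModule R`, as a complex concentrated in degree zero. The
functor `homComplex · (characterComplex R)` detects quasi-isomorphisms. -/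
abbrev characterComplex : Cplx R :=
  (CochainComplex.singleFunctor (ModuleCat.{u} R) 0).obj (ModuleCat.of R (CharacterModule R))

theorem injective_characterModule_of_flat (M : ModuleCat.{u} R) [Module.Flat R M] :
    Injective (ModuleCat.of R (CharacterModule M)) :=
  (Module.injective_iff_injective_object R _).1
    (Module.Flat.iff_characterModule_injective.1 inferInstance)

theorem injective_single_X {M : ModuleCat.{u} R} [Injective M] (p n : ℤ) :
    Injective (((CochainComplex.singleFunctor (ModuleCat.{u} R) p).obj M).X n) := by
  by_cases hn : n = p
  · subst hn
    exact Injective.of_iso (HomologicalComplex.singleObjXSelf (.up ℤ) n M).symm inferInstance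
  · exact (HomologicalComplex.isZero_single_obj_X _ _ _ _ hn).injective

theorem injective_characterComplex (n : ℤ) : Injective ((characterComplex R).X n) :=
  have := injective_characterModule_of_flat (ModuleCat.of R R)
  injective_single_X 0 n

instance : (characterComplex R).IsKInjective :=
  have := injective_characterComplex (R := R)
  CochainComplex.isKInjective_of_injective _ 0

theorem coneExact_of_dual {X Y : Cplx R} {f : X ⟶ Y}
    (H : ∀ (i j k l : ℤ), i + 1 = j → j + 1 = k → k + 1 = l →
      ∀ (χ : X.X k ⟶ ModuleCat.of R (CharacterModule R))
        (ω : Y.X j ⟶ ModuleCat.of R (CharacterModule R)),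
        Y.d i j ≫ ω = 0 → f.f j ≫ ω = X.d j k ≫ χ →
          ∃ (ω' : Y.X k ⟶ ModuleCat.of R (CharacterModule R))
            (χ' : X.X l ⟶ ModuleCat.of R (CharacterModule R)),
            Y.d j k ≫ ω' = ω ∧ f.f k ≫ ω' + X.d k l ≫ χ' = χ) : ConeExact f := by
  intro i j k l hij hjk hkl x z hx hz
  let N : Submodule R (X.X k × Y.X j) := LinearMap.range
    (((X.d j k).hom.prod (f.f j).hom).coprod ((0 : _ →ₗ[R] _).prod (Y.d i j).hom))
  have mem_N (x' y') : (X.d j k x', f.f j x' + Y.d i j y') ∈ N :=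
    ⟨(x', y'), Prod.ext (add_zero _) rfl⟩
  suffices (x, z) ∈ N by
    obtain ⟨⟨x', y'⟩, h⟩ := this
    exact ⟨x', y', (add_zero _).symm.trans (congrArg Prod.fst h), congrArg Prod.snd h⟩
  by_contra hN
  obtain ⟨θ, hθ, hxz⟩ := exists_linearMap_characterModule_ne_zero N hN
  obtain ⟨ω', χ', hω, hχ⟩ := H i j k l hij hjk hkl (ModuleCat.ofHom (-(θ ∘ₗ .inl R _ _)))
    (ModuleCat.ofHom (θ ∘ₗ .inr R _ _))
    (ModuleCat.hom_ext (LinearMap.ext fun y' ↦ by simpa using hθ _ (mem_N 0 y')))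
    (ModuleCat.hom_ext (LinearMap.ext fun x' ↦ by
      have := hθ _ (mem_N x' 0)
      rw [map_zero, add_zero, ← add_zero (X.d j k x'), ← zero_add (f.f j x'), ← Prod.mk_add_mk,
        map_add] at this
      exact eq_neg_of_add_eq_zero_right this))
  have hz' : ω' (Y.d j k z) = θ (0, z) := ConcreteCategory.congr_hom hω z
  have hx' : ω' (f.f k x) + χ' (X.d k l x) = -θ (x, 0) := ConcreteCategory.congr_hom hχ x
  rw [hx, map_zero, add_zero, hz, hz'] at hx'
  rw [← add_zero x, ← zero_add z, ← Prod.mk_add_mk, map_add, hx', add_neg_cancel] at hxz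
  exact hxz rfl

theorem quasiIso_of_homComplexMapLeft_characterComplex {X Y : Cplx R} (f : X ⟶ Y)
    (hf : QuasiIso (homComplexMapLeft f (characterComplex R))) : QuasiIso f := by
  rw [quasiIso_iff_coneExact] at hf ⊢
  refine coneExact_of_dual fun i j k l hij hjk hkl χ ω hω hχ ↦ ?_
  obtain ⟨(ξ : Cochain Y (characterComplex R) (-k)), (ζ : Cochain X (characterComplex R) (-l)),
      hξ, hζ⟩ := hf (-l) (-k) (-j) (-i) (by lia) (by lia) (by lia)
    ((-j).negOnePow • Cochain.toSingleMk ω (by lia)) (Cochain.toSingleMk χ (by lia)) (by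
      change δ _ _ _ = 0
      rw [δ_units_smul, Cochain.δ_toSingleMk _ _ _ i (by lia), hω]
      simp)
    (by
      change (Cochain.ofHom f).comp _ (zero_add (-j)) = δ (-k) (-j) _
      rw [Cochain.comp_units_smul, ← Cochain.toSingleMk_precomp (g := f), hχ,
        Cochain.δ_toSingleMk _ _ _ j (by lia)])
  obtain ⟨ω', rfl⟩ := Cochain.toSingleMk_surjective ξ k (by lia)
  obtain ⟨χ', hχ'⟩ := Cochain.toSingleMk_surjective ((-k).negOnePow • ζ) l (by lia)
  obtain rfl : (-k).negOnePow • Cochain.toSingleMk χ' (by lia) = ζ := by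
    rw [hχ', smul_smul, Int.units_mul_self, one_smul]
  change δ _ _ _ = _ at hξ
  change (Cochain.ofHom f).comp _ (zero_add (-k)) + δ (-l) (-k) _ = _ at hζ
  rw [Cochain.δ_toSingleMk _ _ _ j (by lia)] at hξ
  rw [← Cochain.toSingleMk_precomp, δ_units_smul, Cochain.δ_toSingleMk _ _ _ k (by lia),
    smul_smul, Int.units_mul_self, one_smul] at hζ
  exact ⟨ω', χ', (Cochain.toSingleEquiv (by lia)).symm.injective (smul_left_cancel _ hξ),
    (Cochain.toSingleEquiv (by lia)).symm.injective ((Cochain.toSingleMk_add _ _ _).trans hζ)⟩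

end CharacterDuality

section HomApply

variable {R : Type u} [CommRing R]

theorem linearMap_units_smul {M N : Type u} [AddCommGroup M] [AddCommGroup N] [Module R M]
    [Module R N] (f : M →ₗ[R] N) (e : ℤˣ) (x : M) : f (e • x) = e • f x := by
  rw [Units.smul_def, Units.smul_def, map_zsmul]

variable {X Y : Cplx R} {n p q : ℤ}

/-- Evaluation of the degree `n` elements of `Hom(X, Y)` in degree `p`, as a bilinear map. -/
def homApply (h : p + n = q) : (homComplex X Y).X n →ₗ[R] X.X p →ₗ[R] Y.X q where
  toFun z := (Cochain.v (F := X) (G := Y) z p q h).hom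
  map_add' _ _ := rfl
  map_smul' _ _ := rfl

/-- The degree `n` element of `Hom(X, Y)` with given components. -/
def homMk (β : ∀ p q : ℤ, p + n = q → X.X p →ₗ[R] Y.X q) : (homComplex X Y).X n :=
  (Cochain.mk fun p q h ↦ ModuleCat.ofHom (β p q h) : Cochain X Y n)

theorem homApply_homMk (β : ∀ p q : ℤ, p + n = q → X.X p →ₗ[R] Y.X q) (h : p + n = q) :
    homApply h (homMk β) = β p q h := rfl

theorem homApply_ext {z z' : (homComplex X Y).X n}
    (H : ∀ (p q : ℤ) (h : p + n = q) (x : X.X p), homApply h z x = homApply h z' x) : z = z' :=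
  Cochain.ext (z₁ := (z : Cochain X Y n)) (z₂ := z') fun p q h ↦
    ModuleCat.hom_ext (LinearMap.ext (H p q h))

/-- A bilinear map into a component of `Hom(X, Y)`, from its values. -/
def homMk₂ {M N : Type u} [AddCommGroup M] [Module R M] [AddCommGroup N] [Module R N]
    (β : ∀ p q : ℤ, p + n = q → M →ₗ[R] N →ₗ[R] X.X p →ₗ[R] Y.X q) :
    M →ₗ[R] N →ₗ[R] (homComplex X Y).X n :=
  LinearMap.mk₂ R (fun a b ↦ homMk fun p q h ↦ β p q h a b)
    (fun a a' b ↦ homApply_ext fun p q h ↦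
      LinearMap.congr_fun (LinearMap.map_add₂ (β p q h) a a' b))
    (fun r a b ↦ homApply_ext fun p q h ↦
      LinearMap.congr_fun (LinearMap.map_smul₂ (β p q h) r a b))
    (fun a b b' ↦ homApply_ext fun p q h ↦ LinearMap.congr_fun (map_add (β p q h a) b b'))
    (fun r a b ↦ homApply_ext fun p q h ↦ LinearMap.congr_fun (map_smul (β p q h a) r b))

theorem homApply_d {n' p' q' : ℤ} (hn : n + 1 = n') (hp : p + 1 = p') (hq : q + 1 = q')
    (h : p + n = q) (h₁ : p + n' = q') (h₂ : p' + n = q') (z : (homComplex X Y).X n) (x : X.X p) :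
    homApply h₁ ((homComplex X Y).d n n' z) x =
      Y.d q q' (homApply h z x) + n'.negOnePow • homApply h₂ z (X.d p p' x) := by
  have e := ConcreteCategory.congr_hom
    (δ_v n n' hn (z : Cochain X Y n) p q' h₁ q p' (by lia) hp) x
  exact e.trans (congrArg (Y.d q q' (homApply h z x) + ·) (units_smul_apply n'.negOnePow
    (X.d p p' ≫ Cochain.v (F := X) (G := Y) z p' q' h₂) x))

theorem homApply_homComplexMapRight {Y' : Cplx R} (g : Y ⟶ Y') (h : p + n = q)
    (z : (homComplex X Y).X n) (x : X.X p) :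
    homApply h ((homComplexMapRight X g).f n z) x = g.f q (homApply h z x) := by
  have e := ConcreteCategory.congr_hom
    (Cochain.comp_zero_cochain_v (z : Cochain X Y n) (Cochain.ofHom g) p q h) x
  rwa [Cochain.ofHom_v] at e

theorem homApply_homComplexMapLeft {X' : Cplx R} (f : X' ⟶ X) (h : p + n = q)
    (z : (homComplex X Y).X n) (x : X'.X p) :
    homApply h ((homComplexMapLeft f Y).f n z) x = homApply h z (f.f p x) := by
  have e := ConcreteCategory.congr_hom
    (Cochain.zero_cochain_comp_v (Cochain.ofHom f) (z : Cochain X Y n) p q h) x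
  rwa [Cochain.ofHom_v] at e

theorem homComplex_hom_ext {A : Cplx R} {f g : A ⟶ homComplex X Y}
    (H : ∀ (n p q : ℤ) (h : p + n = q) (a : A.X n) (x : X.X p),
      homApply h (f.f n a) x = homApply h (g.f n a) x) : f = g := by
  ext n : 1
  exact ModuleCat.hom_ext (LinearMap.ext fun a ↦ homApply_ext fun p q h x ↦ H n p q h a x)

/-- Morphisms into a Hom complex, from compatible families of bilinear maps. -/
def homComplexLift {A : Cplx R} (β : ∀ n p q : ℤ, p + n = q → A.X n →ₗ[R] X.X p →ₗ[R] Y.X q)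
    (hβ : ∀ (n p q n' p' q' : ℤ) (_ : n + 1 = n') (_ : p + 1 = p') (_ : q + 1 = q')
      (h : p + n = q) (h₁ : p + n' = q') (h₂ : p' + n = q') (a : A.X n) (x : X.X p),
      β n' p q' h₁ (A.d n n' a) x =
        Y.d q q' (β n p q h a x) + n'.negOnePow • β n p' q' h₂ a (X.d p p' x)) :
    A ⟶ homComplex X Y where
  f n := ModuleCat.ofHom
    { toFun a := homMk fun p q h ↦ β n p q h a
      map_add' a b := homApply_ext fun p q h x ↦
        LinearMap.congr_fun (map_add (β n p q h) a b) x
      map_smul' r a := homApply_ext fun p q h x ↦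
        LinearMap.congr_fun (map_smul (β n p q h) r a) x }
  comm' n n' hn := by
    have hn : n + 1 = n' := hn
    refine ModuleCat.hom_ext (LinearMap.ext fun a ↦ homApply_ext fun p q h x ↦ ?_)
    exact (homApply_d hn rfl (by lia) rfl h (by lia) _ x).trans
      (hβ n p _ n' (p + 1) q hn rfl (by lia) rfl h (by lia) a x).symm

end HomApply

section Tensor

variable {R : Type u} [CommRing R]

/-- A family of bilinear maps induces a map on a component of the tensor product complex. -/
def tensorDescX {X Y : Cplx R} {q : ℤ} {M : ModuleCat.{u} R}
    (β : ∀ p n : ℤ, p + n = q → X.X p →ₗ[R] Y.X n →ₗ[R] M) : (tensorComplex X Y).X q ⟶ M :=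
  HomologicalComplex.mapBifunctorDesc fun p n h ↦ ModuleCat.ofHom (TensorProduct.lift (β p n h))

theorem tensorDescX_tmul {X Y : Cplx R} {q : ℤ} {M : ModuleCat.{u} R}
    (β : ∀ p n : ℤ, p + n = q → X.X p →ₗ[R] Y.X n →ₗ[R] M) (p n : ℤ) (h : p + n = q)
    (x : X.X p) (y : Y.X n) : tensorDescX β (tmul X Y p n q h x y) = β p n h x y := by
  have e := HomologicalComplex.ι_mapBifunctorDesc (K₁ := X) (K₂ := Y)
    (F := MonoidalCategory.curriedTensor (ModuleCat.{u} R)) (c := ComplexShape.up ℤ)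
    (fun (p n : ℤ) (h : p + n = q) ↦ ModuleCat.ofHom (TensorProduct.lift (β p n h))) p n h
  exact LinearMap.congr_fun (congrArg ModuleCat.Hom.hom e) ((x ⊗ₜ[R] y : X.X p ⊗[R] Y.X n))

/-- Morphisms out of the tensor product complex, from families of bilinear maps which satisfy the
Leibniz rule. -/
def tensorDesc {X Y Z : Cplx R}
    (β : ∀ p n q : ℤ, p + n = q → X.X p →ₗ[R] Y.X n →ₗ[R] Z.X q)
    (hβ : ∀ (p n q p' n' q' : ℤ) (h : p + n = q) (_ : p + 1 = p') (_ : n + 1 = n')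
      (h₁ : p' + n = q') (h₂ : p + n' = q') (x : X.X p) (y : Y.X n),
      Z.d q q' (β p n q h x y) =
        β p' n q' h₁ (X.d p p' x) y + p.negOnePow • β p n' q' h₂ x (Y.d n n' y)) :
    tensorComplex X Y ⟶ Z where
  f q := tensorDescX fun p n h ↦ β p n q h
  comm' q q' hq := by
    have hq : q + 1 = q' := hq
    refine tensorComplex_hom_ext fun p n h x y ↦ ?_
    rw [ModuleCat.comp_apply, ModuleCat.comp_apply, tensorDescX_tmul,
      tmul_d X Y p n q (p + 1) (n + 1) q' h rfl rfl (by lia) (by lia), map_add, map_units_smul,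
      tensorDescX_tmul, tensorDescX_tmul]
    exact hβ p n q (p + 1) (n + 1) q' h rfl rfl _ _ x y

theorem tensorDesc_tmul {X Y Z : Cplx R}
    (β : ∀ p n q : ℤ, p + n = q → X.X p →ₗ[R] Y.X n →ₗ[R] Z.X q) (hβ) (p n q : ℤ)
    (h : p + n = q) (x : X.X p) (y : Y.X n) :
    (tensorDesc β hβ).f q (tmul X Y p n q h x y) = β p n q h x y :=
  tensorDescX_tmul (fun p n h ↦ β p n q h) p n h x y

theorem tensorComplex_ext {X Y Z : Cplx R} {f g : tensorComplex X Y ⟶ Z}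
    (H : ∀ (p n q : ℤ) (h : p + n = q) (x : X.X p) (y : Y.X n),
      f.f q (tmul X Y p n q h x y) = g.f q (tmul X Y p n q h x y)) : f = g := by
  ext q : 1
  exact tensorComplex_hom_ext fun p n h x y ↦ H p n q h x y

/-- Functoriality of the tensor product complex. -/
def tensorMap {X X' Y Y' : Cplx R} (f : X ⟶ X') (g : Y ⟶ Y') :
    tensorComplex X Y ⟶ tensorComplex X' Y' :=
  tensorDesc (fun p n q h ↦ (tmul X' Y' p n q h).compl₁₂ (f.f p).hom (g.f n).hom) (by
    intro p n q p' n' q' h hp hn h₁ h₂ x y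
    have e := tmul_d X' Y' p n q p' n' q' h hp hn h₁ h₂ (f.f p x) (g.f n y)
    rw [← comm_apply, ← comm_apply] at e
    exact e)

theorem tensorMap_tmul {X X' Y Y' : Cplx R} (f : X ⟶ X') (g : Y ⟶ Y') (p n q : ℤ)
    (h : p + n = q) (x : X.X p) (y : Y.X n) :
    (tensorMap f g).f q (tmul X Y p n q h x y) = tmul X' Y' p n q h (f.f p x) (g.f n y) :=
  tensorDesc_tmul _ _ _ _ _ _ _ _

end Tensor

section Transpose

variable {R : Type u} [CommRing R]

/-- The morphism `A ⟶ Hom(E, B)` adjoint to `E ⊗ A ⟶ B`. -/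
def transpose {E A B : Cplx R} (v : tensorComplex E A ⟶ B) : A ⟶ homComplex E B :=
  toHomTensor E A ≫ homComplexMapRight E v

theorem homApply_toHomTensor (E A : Cplx R) {n p q : ℤ} (h : p + n = q) (a : A.X n) (e : E.X p) :
    homApply h ((toHomTensor E A).f n a) e = (p * n).negOnePow • tmul E A p n q h e a :=
  units_smul_apply _ _ _

theorem homApply_transpose {E A B : Cplx R} (v : tensorComplex E A ⟶ B) {n p q : ℤ}
    (h : p + n = q) (a : A.X n) (e : E.X p) :
    homApply h ((transpose v).f n a) e =
      (p * n).negOnePow • v.f q (tmul E A p n q h e a) :=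
  (homApply_homComplexMapRight v h _ e).trans
    ((congrArg (v.f q) (homApply_toHomTensor E A h a e)).trans (map_units_smul _ _ _))

theorem tensorHomEval_tmul (P Y : Cplx R) {p n q : ℤ} (h : p + n = q) (y : P.X p)
    (z : (homComplex P Y).X n) :
    (tensorHomEval P Y).f q (tmul P (homComplex P Y) p n q h y z) =
      (p * n).negOnePow • homApply h z y :=
  evalAux_tmul P Y p n q h y z

/-- The morphism `E ⊗ A ⟶ B` adjoint to `A ⟶ Hom(E, B)`. -/
def untranspose {E A B : Cplx R} (u : A ⟶ homComplex E B) : tensorComplex E A ⟶ B :=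
  tensorMap (𝟙 E) u ≫ tensorHomEval E B

theorem untranspose_tmul {E A B : Cplx R} (u : A ⟶ homComplex E B) {p n q : ℤ} (h : p + n = q)
    (e : E.X p) (a : A.X n) : (untranspose u).f q (tmul E A p n q h e a) =
      (p * n).negOnePow • homApply h (u.f n a) e :=
  (congrArg _ (tensorMap_tmul _ _ p n q h e a)).trans (tensorHomEval_tmul E B h e _)

theorem untranspose_transpose {E A B : Cplx R} (v : tensorComplex E A ⟶ B) :
    untranspose (transpose v) = v := by
  refine tensorComplex_ext fun p n q h e a ↦ ?_
  rw [untranspose_tmul, homApply_transpose, smul_smul, Int.units_mul_self, one_smul]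

theorem transpose_untranspose {E A B : Cplx R} (u : A ⟶ homComplex E B) :
    transpose (untranspose u) = u := by
  refine homComplex_hom_ext fun n p q h a e ↦ ?_
  rw [homApply_transpose, untranspose_tmul, smul_smul, Int.units_mul_self, one_smul]

end Transpose

section Curry

variable {R : Type u} [CommRing R] (E A Z : Cplx R)

/-- The components of `curry`, with the sign of the transposition of `E` and `A`. -/
def curryAux {k n m : ℤ} (h : n + k = m) :
    (homComplex (tensorComplex E A) Z).X k →ₗ[R] A.X n →ₗ[R] (homComplex E Z).X m :=
  homMk₂ fun p q _ ↦ (p * n).negOnePow •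
    (LinearMap.lcomp R (E.X p →ₗ[R] Z.X q) (tmul E A p n (p + n) rfl).flip ∘ₗ
      LinearMap.llcomp R (E.X p) ((tensorComplex E A).X (p + n)) (Z.X q) ∘ₗ
        homApply (by lia))

variable {E A Z} in
theorem homApply_curryAux {k n m p q r : ℤ} (h : n + k = m) (hq : p + m = q) (hr : p + n = r)
    (hk : r + k = q) (z : (homComplex (tensorComplex E A) Z).X k) (a : A.X n) (e : E.X p) :
    homApply hq (curryAux E A Z h z a) e =
      (p * n).negOnePow • homApply hk z (tmul E A p n r hr e a) := by
  subst hr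
  rfl

/-- The adjunction morphism `Hom(E ⊗ A, Z) ⟶ Hom(A, Hom(E, Z))`. -/
def curry : homComplex (tensorComplex E A) Z ⟶ homComplex A (homComplex E Z) :=
  homComplexLift (fun _ _ _ h ↦ curryAux E A Z h) (by
    intro k n m k' n' m' hk hn hm h h₁ h₂ z a
    refine homApply_ext fun p q hq e ↦ ?_
    have sign₁ : m'.negOnePow * ((p + 1) * n).negOnePow = (p * n).negOnePow * k'.negOnePow := by
      rw [← Int.negOnePow_add, ← Int.negOnePow_add, show m' + (p + 1) * n = p * n + k' + 2 * n by
        rw [← h₁]; ring, Int.negOnePow_add, Int.negOnePow_two_mul, mul_one]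
    have sign₂ : p.negOnePow * (p * n).negOnePow = (p * n').negOnePow := by
      rw [← Int.negOnePow_add, ← hn, mul_add, mul_one, add_comm]
    rw [map_add, LinearMap.add_apply, linearMap_units_smul, LinearMap.smul_apply,
      homApply_d hm (p := p) (p' := p + 1) (q := q - 1) (q' := q) rfl (by lia) (by lia)
        (by lia) (by lia),
      homApply_curryAux h₁ hq rfl (by lia), homApply_curryAux h _ rfl (by lia),
      homApply_curryAux h _ (show _ = p + n' by lia) (by lia),
      homApply_curryAux h₂ _ (show _ = p + n' by lia) (by lia),
      homApply_d hk (p := p + n) (p' := p + n') (q := q - 1) (q' := q) (by lia) (by lia) (by lia)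
        (by lia) (by lia) z,
      tmul_d E A p n (p + n) (p + 1) n' (p + n') rfl rfl hn (by lia) rfl,
      map_add, map_units_smul, linearMap_units_smul]
    simp only [smul_add, smul_smul, sign₁, ← sign₂]
    rw [← add_assoc, mul_left_comm, mul_comm (p * n).negOnePow p.negOnePow])

variable {E A Z} in
theorem homApply_curry {k n m p q r : ℤ} (h : n + k = m) (hq : p + m = q) (hr : p + n = r)
    (hk : r + k = q) (z : (homComplex (tensorComplex E A) Z).X k) (a : A.X n) (e : E.X p) :
    homApply hq (homApply h ((curry E A Z).f k z) a) e =
      (p * n).negOnePow • homApply hk z (tmul E A p n r hr e a) :=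
  homApply_curryAux h hq hr hk z a e

theorem bijective_curry (k : ℤ) : Function.Bijective ((curry E A Z).f k) := by
  refine ⟨fun z z' hz ↦ homApply_ext fun r q h x ↦ ?_, fun w ↦ ?_⟩
  · refine ConcreteCategory.congr_hom (tensorComplex_hom_ext (f := ModuleCat.ofHom (homApply h z))
      (g := ModuleCat.ofHom (homApply h z')) fun p n hr e a ↦
        smul_left_cancel (p * n).negOnePow ?_) x
    have hz := congrArg (fun t ↦ homApply (q := q) (by lia) (homApply (n := k) rfl t a) e) hz
    exact ((homApply_curry rfl _ hr h z a e).symm.trans hz).trans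
      (homApply_curry rfl _ hr h z' a e)
  · refine ⟨homMk fun r q h ↦ (tensorDescX (M := Z.X q) fun p n hr ↦ (p * n).negOnePow •
      (homApply (p := p) (n := n + k) (q := q) (by lia) ∘ₗ homApply rfl w).flip).hom, ?_⟩
    refine homApply_ext fun n m h a ↦ homApply_ext fun p q hq e ↦ ?_
    subst h
    rw [homApply_curry rfl hq rfl (by lia), homApply_homMk]
    refine (congrArg _ (tensorDescX_tmul _ p n rfl e a)).trans ?_
    exact (smul_smul _ _ _).trans (by rw [Int.units_mul_self, one_smul]; rfl)

instance : QuasiIso (curry E A Z) := quasiIso_of_bijective _ (bijective_curry E A Z)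

variable {E A Z}

theorem homComplexMapLeft_tensorMap_comp_curry {E' A' : Cplx R} (f : E ⟶ E') (g : A ⟶ A') :
    homComplexMapLeft (tensorMap f g) Z ≫ curry E A Z =
      curry E' A' Z ≫ homComplexMapLeft g (homComplex E' Z) ≫
        homComplexMapRight A (homComplexMapLeft f Z) := by
  refine homComplex_hom_ext fun k n m h z a ↦ homApply_ext fun p q hq e ↦ ?_
  simp only [HomologicalComplex.comp_f, ModuleCat.comp_apply]
  rw [homApply_curry h hq rfl (by lia), homApply_homComplexMapLeft, tensorMap_tmul,
    homApply_homComplexMapRight, homApply_homComplexMapLeft, homApply_homComplexMapLeft,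
    homApply_curry h hq rfl (by lia)]

end Curry

section DualComplex

variable {R : Type u} [CommRing R]

theorem isZero_homComplex_X {X Y : Cplx R} {n : ℤ}
    (H : ∀ p q : ℤ, p + n = q → Limits.IsZero (X.X p) ∨ Limits.IsZero (Y.X q)) :
    Limits.IsZero ((homComplex X Y).X n) := by
  have : Subsingleton ((homComplex X Y).X n) := ⟨fun z z' ↦ homApply_ext fun p q h x ↦ by
    rcases H p q h with hX | hY
    · have := ModuleCat.subsingleton_of_isZero hX
      rw [Subsingleton.elim x 0, map_zero, map_zero]
    · have := ModuleCat.subsingleton_of_isZero hY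
      exact Subsingleton.elim _ _⟩
  exact ModuleCat.isZero_of_subsingleton _

theorem isStrictlyGE_homComplex (X Y : Cplx R) {a b c : ℤ} (h : a + c = b) [X.IsStrictlyLE a]
    [Y.IsStrictlyGE b] : (homComplex X Y).IsStrictlyGE c := by
  refine CochainComplex.isStrictlyGE_iff _ _ |>.2 fun n hn ↦ isZero_homComplex_X fun p q hpq ↦ ?_
  rcases lt_or_ge a p with hp | hp
  · exact .inl (X.isZero_of_isStrictlyLE a p hp)
  · exact .inr (Y.isZero_of_isStrictlyGE b q (by lia))

theorem isStrictlyLE_homComplex (X Y : Cplx R) {a b c : ℤ} (h : a + c = b) [X.IsStrictlyGE a]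
    [Y.IsStrictlyLE b] : (homComplex X Y).IsStrictlyLE c := by
  refine CochainComplex.isStrictlyLE_iff _ _ |>.2 fun n hn ↦ isZero_homComplex_X fun p q hpq ↦ ?_
  rcases lt_or_ge p a with hp | hp
  · exact .inl (X.isZero_of_isStrictlyGE a p hp)
  · exact .inr (Y.isZero_of_isStrictlyLE b q (by lia))

/-- The terms of `Hom(U, characterComplex R)` are the character modules of the terms of `U`. -/
def homCharacterComplexXIso (U : Cplx R) {n p : ℤ} (h : p + n = 0) :
    (homComplex U (characterComplex R)).X n ≅ ModuleCat.of R (CharacterModule (U.X p)) :=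
  let e : (homComplex U (characterComplex R)).X n ≃ₗ[R] (U.X p →ₗ[R] CharacterModule R) :=
    { (Cochain.toSingleEquiv h).trans ModuleCat.homAddEquiv with map_smul' := fun _ _ ↦ rfl }
  (e.trans (CharacterModule.homEquiv.trans
    (CharacterModule.congr (TensorProduct.rid R _)))).toModuleIso

theorem injective_homComplex_characterComplex {U : Cplx R} (hU : ∀ n, Module.Flat R (U.X n))
    (n : ℤ) : Injective ((homComplex U (characterComplex R)).X n) :=
  have := hU (-n)
  Injective.of_iso (homCharacterComplexXIso U (neg_add_cancel n)).symm
    (injective_characterModule_of_flat _)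

theorem isKInjective_homComplex_characterComplex {U : Cplx R}
    (hU : ∀ n, Module.Flat R (U.X n)) (b : ℤ) [U.IsStrictlyLE b] :
    (homComplex U (characterComplex R)).IsKInjective :=
  have := injective_homComplex_characterComplex hU
  have := isStrictlyGE_homComplex U (characterComplex R) (add_neg_cancel b)
  CochainComplex.isKInjective_of_injective _ (-b)

end DualComplex

section TensorQuasiIso

variable {R : Type u} [CommRing R]

theorem homComplexMapLeft_id (X Y : Cplx R) : homComplexMapLeft (𝟙 X) Y = 𝟙 _ :=
  homComplex_hom_ext fun _ _ _ h z x ↦ homApply_homComplexMapLeft (𝟙 X) h z x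

theorem homComplexMapRight_id (X Y : Cplx R) : homComplexMapRight X (𝟙 Y) = 𝟙 _ :=
  homComplex_hom_ext fun _ _ _ h z x ↦ homApply_homComplexMapRight (𝟙 Y) h z x

theorem quasiIso_tensorMap_of_curry {E E' A A' : Cplx R} (f : E ⟶ E') (g : A ⟶ A')
    (h : QuasiIso (homComplexMapLeft g (homComplex E' (characterComplex R)) ≫
      homComplexMapRight A (homComplexMapLeft f (characterComplex R)))) :
    QuasiIso (tensorMap f g) := by
  apply quasiIso_of_homComplexMapLeft_characterComplex
  rw [← quasiIso_iff_comp_right _ (curry E A (characterComplex R)),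
    homComplexMapLeft_tensorMap_comp_curry]
  infer_instance

theorem quasiIso_tensorMap_id_right {E E' : Cplx R} (f : E ⟶ E') (hf : QuasiIso f) (P : Cplx R)
    [P.IsKProjective] : QuasiIso (tensorMap f (𝟙 P)) := by
  apply quasiIso_tensorMap_of_curry
  rw [homComplexMapLeft_id, Category.id_comp]
  exact quasiIso_homComplexMapRight P _ (quasiIso_homComplexMapLeft f _ hf)

theorem quasiIso_tensorMap_id_left {P : Cplx R} (hP : ∀ n, Module.Flat R (P.X n)) (b : ℤ)
    [P.IsStrictlyLE b] {A A' : Cplx R} (g : A ⟶ A') (hg : QuasiIso g) :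
    QuasiIso (tensorMap (𝟙 P) g) := by
  have := isKInjective_homComplex_characterComplex hP b
  apply quasiIso_tensorMap_of_curry
  rw [homComplexMapLeft_id, homComplexMapRight_id, Category.comp_id]
  exact quasiIso_homComplexMapLeft g _ hg

end TensorQuasiIso

section Exactness

variable {R : Type u} [CommRing R]

/-- A degreewise short exact sequence of complexes. -/
structure DegreewiseExact {X₁ X₂ X₃ : Cplx R} (i : X₁ ⟶ X₂) (p : X₂ ⟶ X₃) : Prop where
  injective : ∀ n, Function.Injective (i.f n)
  exact : ∀ n, Function.Exact (i.f n) (p.f n)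
  surjective : ∀ n, Function.Surjective (p.f n)

namespace DegreewiseExact

variable {X₁ X₂ X₃ Y₁ Y₂ Y₃ : Cplx R} {i : X₁ ⟶ X₂} {p : X₂ ⟶ X₃} {i' : Y₁ ⟶ Y₂} {p' : Y₂ ⟶ Y₃}

theorem zero (h : DegreewiseExact i p) : i ≫ p = 0 := by
  ext n x
  exact (h.exact n).apply_apply_eq_zero x

theorem zero_f (h : DegreewiseExact i p) (n : ℤ) : i.f n ≫ p.f n = 0 := by
  rw [← HomologicalComplex.comp_f, h.zero, HomologicalComplex.zero_f]

theorem shortExact_f (h : DegreewiseExact i p) (n : ℤ) :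
    (ShortComplex.mk (i.f n) (p.f n) (h.zero_f n)).ShortExact :=
  ModuleCat.shortComplex_shortExact _ (h.exact n) (h.injective n) (h.surjective n)

theorem shortExact (h : DegreewiseExact i p) : (ShortComplex.mk i p h.zero).ShortExact :=
  HomologicalComplex.shortExact_of_degreewise_shortExact _ h.shortExact_f

attribute [local instance] HasDerivedCategory.standard in
theorem quasiIso_two_of_three (hX : DegreewiseExact i p) (hY : DegreewiseExact i' p')
    {v₁ : X₁ ⟶ Y₁} {v₂ : X₂ ⟶ Y₂} {v₃ : X₃ ⟶ Y₃} (h₁₂ : v₁ ≫ i' = i ≫ v₂)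
    (h₂₃ : v₂ ≫ p' = p ≫ v₃) :
    (QuasiIso v₂ → QuasiIso v₃ → QuasiIso v₁) ∧ (QuasiIso v₁ → QuasiIso v₃ → QuasiIso v₂) ∧
      (QuasiIso v₁ → QuasiIso v₂ → QuasiIso v₃) := by
  let φ : ShortComplex.mk i p hX.zero ⟶ ShortComplex.mk i' p' hY.zero :=
    { τ₁ := v₁, τ₂ := v₂, τ₃ := v₃, comm₁₂ := h₁₂, comm₂₃ := h₂₃ }
  let ψ := DerivedCategory.triangleOfSES.map hX.shortExact hY.shortExact φ
  have e₁ : QuasiIso v₁ ↔ IsIso ψ.hom₁ := (DerivedCategory.isIso_Q_map_iff_quasiIso _ v₁).symm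
  have e₂ : QuasiIso v₂ ↔ IsIso ψ.hom₂ := (DerivedCategory.isIso_Q_map_iff_quasiIso _ v₂).symm
  have e₃ : QuasiIso v₃ ↔ IsIso ψ.hom₃ := (DerivedCategory.isIso_Q_map_iff_quasiIso _ v₃).symm
  have dX := DerivedCategory.triangleOfSES_distinguished hX.shortExact
  have dY := DerivedCategory.triangleOfSES_distinguished hY.shortExact
  rw [e₁, e₂, e₃]
  exact ⟨Pretriangulated.isIso₁_of_isIso₂₃ ψ dX dY, Pretriangulated.isIso₂_of_isIso₁₃ ψ dX dY,
    Pretriangulated.isIso₃_of_isIso₁₂ ψ dX dY⟩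

theorem homComplexMapLeft (h : DegreewiseExact i p) (J : Cplx R) (hJ : ∀ n, Injective (J.X n)) :
    DegreewiseExact (homComplexMapLeft p J) (homComplexMapLeft i J) where
  injective n := by
    intro (z : Cochain X₃ J n) (z' : Cochain X₃ J n) hz
    refine Cochain.ext z z' fun a b hab ↦ ?_
    have := (h.shortExact_f a).epi_g
    rw [← cancel_epi (p.f a)]
    simpa [homComplexMapLeft_apply] using congrArg (fun c : Cochain X₂ J n ↦ c.v a b hab) hz
  exact n := by
    intro (z : Cochain X₂ J n)
    constructor
    · intro hz
      have hz' (a b : ℤ) (hab : a + n = b) : i.f a ≫ z.v a b hab = 0 := by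
        have := congrArg (fun c : Cochain X₁ J n ↦ c.v a b hab) hz
        simpa [homComplexMapLeft_apply] using this.trans (Cochain.zero_v a b hab)
      have (a : ℤ) := (h.shortExact_f a).epi_g
      refine ⟨Cochain.mk fun a b hab ↦ (h.shortExact_f a).exact.desc _ (hz' a b hab), ?_⟩
      refine Cochain.ext (Cochain.comp _ _ (zero_add n)) z fun a b hab ↦ ?_
      simpa using (h.shortExact_f a).exact.g_desc _ (hz' a b hab)
    · rintro ⟨y, rfl⟩
      refine homApply_ext fun a b hab x ↦ ?_
      rw [homApply_homComplexMapLeft, homApply_homComplexMapLeft,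
        (h.exact a).apply_apply_eq_zero, map_zero, map_zero, LinearMap.zero_apply]
  surjective n := by
    intro (z : Cochain X₁ J n)
    have (a : ℤ) := (h.shortExact_f a).mono_f
    refine ⟨Cochain.mk fun a b hab ↦ Injective.factorThru (z.v a b hab) (i.f a), ?_⟩
    refine Cochain.ext (Cochain.comp _ _ (zero_add n)) z fun a b hab ↦ ?_
    simp

theorem homComplexMapRight (h : DegreewiseExact i p) (P : Cplx R) (hP : ∀ n, Projective (P.X n)) :
    DegreewiseExact (homComplexMapRight P i) (homComplexMapRight P p) where
  injective n := by
    intro (z : Cochain P X₁ n) (z' : Cochain P X₁ n) hz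
    refine Cochain.ext z z' fun a b hab ↦ ?_
    have := (h.shortExact_f b).mono_f
    rw [← cancel_mono (i.f b)]
    simpa [homComplexMapRight_apply] using congrArg (fun c : Cochain P X₂ n ↦ c.v a b hab) hz
  exact n := by
    intro (z : Cochain P X₂ n)
    constructor
    · intro hz
      have hz' (a b : ℤ) (hab : a + n = b) : z.v a b hab ≫ p.f b = 0 := by
        have := congrArg (fun c : Cochain P X₃ n ↦ c.v a b hab) hz
        simpa [homComplexMapRight_apply] using this.trans (Cochain.zero_v a b hab)
      have (b : ℤ) := (h.shortExact_f b).mono_f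
      refine ⟨Cochain.mk fun a b hab ↦ (h.shortExact_f b).exact.lift _ (hz' a b hab), ?_⟩
      refine Cochain.ext (Cochain.comp _ _ (add_zero n)) z fun a b hab ↦ ?_
      simpa using (h.shortExact_f b).exact.lift_f _ (hz' a b hab)
    · rintro ⟨y, rfl⟩
      refine homApply_ext fun a b hab x ↦ ?_
      rw [homApply_homComplexMapRight, homApply_homComplexMapRight,
        (h.exact b).apply_apply_eq_zero, map_zero, LinearMap.zero_apply]
  surjective n := by
    intro (z : Cochain P X₃ n)
    have (b : ℤ) := (h.shortExact_f b).epi_g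
    refine ⟨Cochain.mk fun a b hab ↦ Projective.factorThru (z.v a b hab) (p.f b), ?_⟩
    refine Cochain.ext (Cochain.comp _ _ (add_zero n)) z fun a b hab ↦ ?_
    simp

end DegreewiseExact

end Exactness

section InjectiveDimension

variable {C : Type*} [Category C] [Abelian C]

theorem exists_Q_map_eq [HasDerivedCategory C] {K L : CochainComplex C ℤ} [L.IsKInjective]
    (g : DerivedCategory.Q.obj K ⟶ DerivedCategory.Q.obj L) :
    ∃ f : K ⟶ L, DerivedCategory.Q.map f = g := by
  let e := DerivedCategory.quotientCompQhIso C
  obtain ⟨f, hf⟩ := (CochainComplex.IsKInjective.Qh_map_bijective _ L).surjective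
    (e.hom.app K ≫ g ≫ e.inv.app L)
  obtain ⟨f, rfl⟩ := (HomotopyCategory.quotient C (.up ℤ)).map_surjective f
  refine ⟨f, ?_⟩
  rw [← cancel_epi (e.hom.app K), ← cancel_mono (e.inv.app L), Category.assoc, Category.assoc, ← hf]
  exact (NatIso.naturality_2 e f).trans rfl

attribute [local instance] HasDerivedCategory.standard in
theorem nonempty_homotopyEquiv_of_isKInjective {Z K L : CochainComplex C ℤ} [K.IsKInjective]
    [L.IsKInjective] (f : Z ⟶ K) (g : Z ⟶ L) [QuasiIso f] [QuasiIso g] :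
    Nonempty (HomotopyEquiv K L) := by
  obtain ⟨h, hh⟩ := exists_Q_map_eq (inv (DerivedCategory.Q.map f) ≫ DerivedCategory.Q.map g)
  have : IsIso (DerivedCategory.Q.map h) := hh ▸ inferInstance
  obtain ⟨e, -⟩ := (CochainComplex.IsKInjective.quasiIso_iff h).1
    ((DerivedCategory.isIso_Q_map_iff_quasiIso _ h).1 this)
  exact ⟨e⟩

theorem hasInjectiveDimensionLT_of_iso_Q [HasDerivedCategory C] {N : C} {V : CochainComplex C ℤ}
    [V.IsKInjective] {b : ℤ} [V.IsStrictlyLE b] {n : ℕ} (hn : b < n)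
    (e : (DerivedCategory.singleFunctor C 0).obj N ≅ DerivedCategory.Q.obj V) :
    HasInjectiveDimensionLT N n := by
  let := HasExt.standard C
  rw [hasInjectiveDimensionLT_iff]
  intro i hi Y x
  let e' := (shiftFunctor _ (i : ℤ)).mapIso e ≪≫ (DerivedCategory.Q.commShiftIso (i : ℤ)).symm.app V
  have hx : x.hom ≫ e'.hom = 0 := by
    obtain ⟨f, hf⟩ := exists_Q_map_eq (K := (CochainComplex.singleFunctor C 0).obj Y)
      (x.hom ≫ e'.hom)
    have hf₀ : f = 0 := HomologicalComplex.from_single_hom_ext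
      ((V.isZero_of_isStrictlyLE b (0 + i) (by lia)).eq_of_tgt _ _)
    exact hf.symm.trans (hf₀ ▸ Functor.map_zero _ _ _)
  refine Abelian.Ext.ext ?_
  rw [← cancel_mono e'.hom, hx, Abelian.Ext.zero_hom, Limits.zero_comp]

end InjectiveDimension

section FlatDimension

variable {R : Type u} [CommRing R]

attribute [local instance] HasDerivedCategory.standard in
theorem FiniteFlatDimension.exists_hasInjectiveDimensionLT {M : ModuleCat.{u} R}
    (hM : FiniteFlatDimension
      ((HomologicalComplex.single (ModuleCat.{u} R) (ComplexShape.up ℤ) 0).obj M)) :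
    ∃ n, HasInjectiveDimensionLT (ModuleCat.of R (CharacterModule M)) n := by
  let K : Cplx R := characterComplex R
  let X : Cplx R := (CochainComplex.singleFunctor (ModuleCat.{u} R) 0).obj M
  obtain ⟨U, hU, ⟨a, b, _, _⟩, Z, (f : Z ⟶ X), g, hf, hg⟩ := hM
  have := isStrictlyGE_homComplex X K (add_zero 0)
  have := isStrictlyLE_homComplex X K (add_zero 0)
  obtain ⟨N, ⟨e⟩⟩ := CochainComplex.exists_iso_single (homComplex X K) 0
  have eN : N ≅ ModuleCat.of R (CharacterModule M) :=
    (HomologicalComplex.singleObjXSelf (.up ℤ) 0 N).symm ≪≫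
      (HomologicalComplex.Hom.isoApp e.symm 0) ≪≫ homCharacterComplexXIso X (add_zero 0) ≪≫
      (CharacterModule.congr
        (HomologicalComplex.singleObjXSelf (.up ℤ) 0 M).toLinearEquiv).toModuleIso
  have := isKInjective_homComplex_characterComplex hU b
  have := isStrictlyLE_homComplex U K (add_neg_cancel a)
  have := quasiIso_homComplexMapLeft f K hf
  have := quasiIso_homComplexMapLeft g K hg
  have hN : HasInjectiveDimensionLT N (-a + 1).toNat :=
    hasInjectiveDimensionLT_of_iso_Q (V := homComplex U K) (b := -a) (by lia) <|
      DerivedCategory.Q.mapIso e.symm ≪≫ asIso (DerivedCategory.Q.map (homComplexMapLeft f K)) ≪≫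
        (asIso (DerivedCategory.Q.map (homComplexMapLeft g K))).symm
  exact ⟨(-a + 1).toNat, hasInjectiveDimensionLT_of_iso eN _⟩

theorem exact_characterModule_dual {M N : Type*} [AddCommGroup M] [Module R M] [AddCommGroup N]
    [Module R N] (p : M →ₗ[R] N) (hp : Function.Surjective p) :
    Function.Exact (CharacterModule.dual p) (CharacterModule.dual (LinearMap.ker p).subtype) := by
  intro c
  constructor
  · intro hc
    let pa : M →+ N := p.toAddMonoidHom
    let d : N →+ AddCircle (1 : ℚ) := AddMonoidHom.liftOfRightInverse pa _
      (Function.rightInverse_surjInv hp)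
      ⟨c, fun x hx ↦ DFunLike.congr_fun (F := CharacterModule _) hc (⟨x, hx⟩ : LinearMap.ker p)⟩
    exact ⟨d, DFunLike.ext _ _ fun x ↦
      AddMonoidHom.liftOfRightInverse_comp_apply pa _ (Function.rightInverse_surjInv hp) _ x⟩
  · rintro ⟨c, rfl⟩
    exact DFunLike.ext _ _ fun x ↦ (congrArg c x.2).trans (map_zero c)

theorem hasProjectiveDimensionLT_of_characterModule [IsNoetherianRing R] {n : ℕ} :
    ∀ (M : ModuleCat.{u} R) [Module.Finite R M]
      [HasInjectiveDimensionLT (ModuleCat.of R (CharacterModule M)) (n + 1)],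
      HasProjectiveDimensionLT M (n + 1) := by
  induction n with
  | zero =>
    intro M _ _
    have : Module.Flat R M := Module.Flat.iff_characterModule_injective.2
      ((Module.injective_iff_injective_object R _).2 inferInstance)
    have := Module.finitePresentation_of_finite R M
    have : Module.Projective R M := Module.Flat.projective_of_finitePresentation
    infer_instance
  | succ n ih =>
    intro M _ hM
    obtain ⟨k, p, hp⟩ := Module.Finite.exists_fin' R M
    let K := LinearMap.ker p
    have hF := LinearMap.shortExact_shortComplexKer hp
    have hD : (ShortComplex.mk (ModuleCat.ofHom (CharacterModule.dual p))
        (ModuleCat.ofHom (CharacterModule.dual K.subtype)) (by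
          ext c x
          exact (congrArg c x.2).trans (map_zero c))).ShortExact :=
      ModuleCat.shortComplex_shortExact _ (exact_characterModule_dual p hp)
        (CharacterModule.dual_injective_of_surjective p hp)
        (CharacterModule.dual_surjective_of_injective K.subtype Subtype.val_injective)
    have := (hD.hasInjectiveDimensionLT_X₃_iff n
      (injective_characterModule_of_flat (ModuleCat.of R (Fin k → R)))).2 hM
    exact (hF.hasProjectiveDimensionLT_X₃_iff n inferInstance).2 (ih (ModuleCat.of R K))

theorem FiniteFlatDimension.exists_hasProjectiveDimensionLT [IsNoetherianRing R]
    {M : ModuleCat.{u} R} [Module.Finite R M]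
    (hM : FiniteFlatDimension
      ((HomologicalComplex.single (ModuleCat.{u} R) (ComplexShape.up ℤ) 0).obj M)) :
    ∃ n, HasProjectiveDimensionLT M n := by
  obtain ⟨n, _⟩ := hM.exists_hasInjectiveDimensionLT
  have := hasInjectiveDimensionLT_of_ge (ModuleCat.of R (CharacterModule M)) n (n + 1) n.le_succ
  exact ⟨n + 1, hasProjectiveDimensionLT_of_characterModule M⟩

end FlatDimension

section Devissage

variable {R : Type u} [CommRing R]

/-- Dévissage: modules with finite projective resolutions by finite modules are built from `R` by
extensions, retracts and cokernels of monomorphisms. -/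
theorem prop_of_hasProjectiveDimensionLT [IsNoetherianRing R] (C : ObjectProperty (ModuleCat.{u} R))
    [C.IsClosedUnderExtensions] [C.IsStableUnderRetracts]
    (hC : ∀ {S : ShortComplex (ModuleCat.{u} R)}, S.ShortExact → C S.X₁ → C S.X₂ → C S.X₃)
    (hR : C (ModuleCat.of R R)) {n : ℕ} :
    ∀ (M : ModuleCat.{u} R) [Module.Finite R M] [HasProjectiveDimensionLT M n], C M := by
  have hfree (k : ℕ) : C (ModuleCat.of R (Fin k → R)) := by
    induction k with
    | zero =>
      exact C.prop_of_retract (X := ModuleCat.of R (Fin 0 → R)) (Y := ModuleCat.of R R)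
        ⟨0, 0, ModuleCat.hom_ext (Subsingleton.elim _ _)⟩ hR
    | succ k ih =>
      exact C.prop_of_retract (.ofIso ((Fin.consLinearEquiv R fun _ ↦ R).symm.toModuleIso ≪≫
        (ModuleCat.biprodIsoProd (.of R R) (.of R (Fin k → R))).symm)) (C.prop_biprod hR ih)
  induction n with
  | zero =>
    intro M _ hM
    have hM := (hasProjectiveDimensionLT_zero_iff_isZero M).1 hM
    exact C.prop_of_retract ⟨0, 0, hM.eq_of_src _ _⟩ hR
  | succ n ih =>
    intro M _ hM
    obtain ⟨k, p, hp⟩ := Module.Finite.exists_fin' R M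
    have hF := LinearMap.shortExact_shortComplexKer hp
    cases n with
    | zero =>
      have : Projective M := (projective_iff_hasProjectiveDimensionLT_one).2 hM
      have : Epi (ModuleCat.ofHom p) := hF.epi_g
      obtain ⟨s, hs⟩ := Projective.factors (𝟙 M) (ModuleCat.ofHom p)
      exact C.prop_of_retract ⟨s, _, hs⟩ (hfree k)
    | succ n =>
      have := (hF.hasProjectiveDimensionLT_X₃_iff n inferInstance).1 hM
      exact hC hF (ih (ModuleCat.of R (LinearMap.ker p))) (hfree k)

end Devissage

section Functoriality

variable {R : Type u} [CommRing R]

/-- The functor `Hom(P, -)` on complexes. -/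
def homComplexFunctorRight (P : Cplx R) : Cplx R ⥤ Cplx R where
  obj := homComplex P
  map := homComplexMapRight P
  map_id _ := homComplexMapRight_id _ _
  map_comp f g := homComplex_hom_ext fun _ _ _ _ _ _ ↦ by
    simp only [HomologicalComplex.comp_f, ModuleCat.comp_apply, homApply_homComplexMapRight]

/-- The functor `Hom(-, K)` on complexes. -/
def homComplexFunctorLeft (K : Cplx R) : (Cplx R)ᵒᵖ ⥤ Cplx R where
  obj X := homComplex X.unop K
  map f := homComplexMapLeft f.unop K
  map_id _ := homComplexMapLeft_id _ _
  map_comp f g := homComplex_hom_ext fun _ _ _ _ _ _ ↦ by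
    simp only [HomologicalComplex.comp_f, ModuleCat.comp_apply, homApply_homComplexMapLeft,
      unop_comp]

/-- The functor `C ↦ H(C)(X)`, for a fixed complex `X` and a functor `H` to additive functors, which
are applied to `X` degreewise. -/
def degreewiseFunctor {𝒞 : Type*} [Category 𝒞] (H : 𝒞 ⥤ ModuleCat.{u} R ⥤ ModuleCat.{u} R)
    [∀ C, (H.obj C).Additive] (X : Cplx R) : 𝒞 ⥤ Cplx R where
  obj C := ((H.obj C).mapHomologicalComplex _).obj X
  map f := (NatTrans.mapHomologicalComplex (H.map f) _).app X
  map_id C := by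
    rw [H.map_id, NatTrans.mapHomologicalComplex_id]
    rfl
  map_comp f g := by
    rw [H.map_comp, NatTrans.mapHomologicalComplex_comp]
    rfl

/-- The contravariant functor `M ↦ Hom_R(M, I)` from modules to complexes. -/
abbrev homModFunctor (I : Cplx R) : (ModuleCat.{u} R)ᵒᵖ ⥤ Cplx R :=
  degreewiseFunctor (linearCoyoneda R (ModuleCat.{u} R)) I

/-- The functor `M ↦ M ⊗_R P` from modules to complexes. -/
abbrev tensorModFunctor (P : Cplx R) : ModuleCat.{u} R ⥤ Cplx R :=
  degreewiseFunctor (MonoidalCategory.curriedTensor (ModuleCat.{u} R)) P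

theorem degreewiseExact_homModFunctor {I : Cplx R} (hI : ∀ n, Injective (I.X n))
    {S : ShortComplex (ModuleCat.{u} R)} (hS : S.ShortExact) :
    DegreewiseExact ((homModFunctor I).map S.g.op) ((homModFunctor I).map S.f.op) where
  injective n := by
    intro (f : S.X₃ ⟶ I.X n) (f' : S.X₃ ⟶ I.X n) (hf : S.g ≫ f = S.g ≫ f')
    have := hS.epi_g
    exact (cancel_epi S.g).1 hf
  exact n := by
    have := hS.epi_g
    intro (f : S.X₂ ⟶ I.X n)
    refine ⟨fun hf ↦ ⟨hS.exact.desc f hf, hS.exact.g_desc f hf⟩, ?_⟩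
    rintro ⟨f : S.X₃ ⟶ I.X n, rfl⟩
    exact (S.zero_assoc f).trans Limits.zero_comp
  surjective n := by
    have := hS.mono_f
    intro (f : S.X₁ ⟶ I.X n)
    exact ⟨Injective.factorThru f S.f, Injective.comp_factorThru f S.f⟩

theorem degreewiseExact_tensorModFunctor {P : Cplx R} (hP : ∀ n, Module.Flat R (P.X n))
    {S : ShortComplex (ModuleCat.{u} R)} (hS : S.ShortExact) :
    DegreewiseExact ((tensorModFunctor P).map S.f) ((tensorModFunctor P).map S.g) where
  injective n := by
    have := hP n
    exact Module.Flat.rTensor_preserves_injective_linearMap S.f.hom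
      ((ModuleCat.mono_iff_injective _).1 hS.mono_f)
  exact n := rTensor_exact (P.X n)
    ((ShortComplex.ShortExact.moduleCat_exact_iff_function_exact S).1 hS.exact)
    ((ModuleCat.epi_iff_surjective _).1 hS.epi_g)
  surjective n := LinearMap.rTensor_surjective (P.X n)
    ((ModuleCat.epi_iff_surjective _).1 hS.epi_g)

/-- `R ⊗_R P ≅ P`. -/
def tensorModFunctorObjSelf (P : Cplx R) :
    (tensorModFunctor P).obj (ModuleCat.of R R) ≅ P :=
  (NatIso.mapHomologicalComplex (F := (MonoidalCategory.curriedTensor _).obj (ModuleCat.of R R))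
    (MonoidalCategory.leftUnitorNatIso (ModuleCat.{u} R)) _).app P ≪≫
    (Functor.mapHomologicalComplexIdIso _ _).app P

/-- `Hom_R(R, I) ≅ I`, by evaluation at `1`. -/
def homModFunctorObjSelf (I : Cplx R) :
    (homModFunctor I).obj (.op (ModuleCat.of R R)) ≅ I :=
  (NatIso.mapHomologicalComplex (F := (linearCoyoneda R _).obj (.op (ModuleCat.of R R))) (G := 𝟭 _)
    (NatIso.ofComponents fun N ↦
      (ModuleCat.homLinearEquiv (S := R) ≪≫ₗ LinearMap.ringLmapEquivSelf R R N).toModuleIso)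
    _).app I ≪≫ (Functor.mapHomologicalComplexIdIso _ _).app I

end Functoriality

section Thick

variable {R : Type u} [CommRing R]

/-- A class of complexes which is closed under retracts and has the two-out-of-three property for
degreewise short exact sequences. -/
structure IsThick (𝒞 : ObjectProperty (Cplx R)) : Prop where
  of_retract {X Y : Cplx R} : Retract X Y → 𝒞 Y → 𝒞 X
  two_of_three {X₁ X₂ X₃ : Cplx R} {i : X₁ ⟶ X₂} {p : X₂ ⟶ X₃} : DegreewiseExact i p →
    (𝒞 X₂ → 𝒞 X₃ → 𝒞 X₁) ∧ (𝒞 X₁ → 𝒞 X₃ → 𝒞 X₂) ∧ (𝒞 X₁ → 𝒞 X₂ → 𝒞 X₃)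

/-- The complexes whose homology in degree `n` has the property `E` for all `n` large enough with
respect to the filter `l`. For `l = ⊤` this is all `n`, and for `l = cofinite` all but finitely
many. -/
def HomologyEventually (E : ObjectProperty (ModuleCat.{u} R)) (l : Filter ℤ) :
    ObjectProperty (Cplx R) :=
  fun X ↦ ∀ᶠ n in l, E (X.homology n)

theorem isThick_homologyEventually (E : ObjectProperty (ModuleCat.{u} R)) [E.IsSerreClass]
    {l : Filter ℤ} (hl : ∀ k : ℤ, Filter.Tendsto (· + k) l l) :
    IsThick (HomologyEventually E l) where
  of_retract r hY := hY.mono fun n hn ↦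
    have : Mono (HomologicalComplex.homologyMap r.i n) :=
      (r.map (HomologicalComplex.homologyFunctor _ _ n)).splitMono.mono
    E.prop_of_mono (HomologicalComplex.homologyMap r.i n) hn
  two_of_three {X₁ X₂ X₃ i p} h := by
    refine ⟨fun h₂ h₃ ↦ ?_, fun h₁ h₃ ↦ ?_, fun h₁ h₂ ↦ ?_⟩
    · filter_upwards [h₂, (hl (-1)).eventually h₃] with n hn₂ hn₃
      exact E.prop_X₂_of_exact (h.shortExact.homology_exact₁ (n + -1) n (by simp)) hn₃ hn₂
    · filter_upwards [h₁, h₃] with n hn₁ hn₃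
      exact E.prop_X₂_of_exact (h.shortExact.homology_exact₂ n) hn₁ hn₃
    · filter_upwards [(hl 1).eventually h₁, h₂] with n hn₁ hn₂
      exact E.prop_X₂_of_exact (h.shortExact.homology_exact₃ n (n + 1) (by simp)) hn₂ hn₁

theorem homologyEventually_congr (E : ObjectProperty (ModuleCat.{u} R))
    [E.IsClosedUnderIsomorphisms] (l : Filter ℤ) {X Y : Cplx R} (f : X ⟶ Y) [QuasiIso f] :
    HomologyEventually E l X ↔ HomologyEventually E l Y :=
  Filter.eventually_congr (.of_forall fun n ↦
    E.prop_iff_of_iso (asIso (HomologicalComplex.homologyMap f n)))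

theorem homologicallyBounded_iff (X : Cplx R) :
    HomologicallyBounded X ↔ HomologyEventually Limits.IsZero .cofinite X := by
  simp only [HomologyEventually, ← HomologicalComplex.exactAt_iff_isZero_homology]
  refine ⟨fun ⟨a, b, _, _⟩ ↦ (Set.finite_Icc a b).subset fun n hn ↦ ⟨?_, ?_⟩, fun h ↦ ?_⟩
  · exact not_lt.1 fun h ↦ hn (X.exactAt_of_isGE a n h)
  · exact not_lt.1 fun h ↦ hn (X.exactAt_of_isLE b n h)
  · have h : {n | ¬ X.ExactAt n}.Finite := h
    obtain ⟨a, ha⟩ := h.bddBelow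
    obtain ⟨b, hb⟩ := h.bddAbove
    exact ⟨a, b, (X.isGE_iff a).2 fun n hn ↦ by_contra fun h ↦ hn.not_ge (ha h),
      (X.isLE_iff b).2 fun n hn ↦ by_contra fun h ↦ hn.not_ge (hb h)⟩

theorem isThick_homologicallyBounded :
    IsThick (HomologicallyBounded : ObjectProperty (Cplx R)) := by
  rw [show HomologicallyBounded = HomologyEventually Limits.IsZero .cofinite from
    funext fun X ↦ propext (homologicallyBounded_iff X)]
  exact isThick_homologyEventually _ fun k ↦ (add_left_injective k).tendsto_cofinite

theorem homologicallyBounded_iff_of_quasiIso {X Y : Cplx R} (f : X ⟶ Y) [QuasiIso f] :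
    HomologicallyBounded X ↔ HomologicallyBounded Y := by
  rw [homologicallyBounded_iff, homologicallyBounded_iff, homologyEventually_congr _ _ f]

/-- Finite generation, as a property of objects of the category of modules. -/
abbrev isFiniteModule (R : Type u) [CommRing R] : ObjectProperty (ModuleCat.{u} R) :=
  fun M ↦ Module.Finite R M

instance [IsNoetherianRing R] : (isFiniteModule R).IsSerreClass where
  exists_zero := ⟨ModuleCat.of R PUnit, ModuleCat.isZero_of_subsingleton _, by infer_instance⟩
  prop_of_mono f _ (_ : Module.Finite R _) :=
    Module.Finite.of_injective f.hom ((ModuleCat.mono_iff_injective f).1 inferInstance)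
  prop_of_epi f _ (_ : Module.Finite R _) :=
    Module.Finite.of_surjective f.hom ((ModuleCat.epi_iff_surjective f).1 inferInstance)
  prop_X₂_of_shortExact {S} hS (_ : Module.Finite R _) (_ : Module.Finite R _) := by
    have hex := (ShortComplex.ShortExact.moduleCat_exact_iff_function_exact S).1 hS.exact
    have : IsNoetherian R S.X₂ := isNoetherian_of_range_eq_ker S.f.hom S.g.hom
      (LinearMap.exact_iff.1 hex).symm
    exact inferInstanceAs (Module.Finite R S.X₂)

theorem isThick_finite_homology [IsNoetherianRing R] :
    IsThick fun X : Cplx R ↦ ∀ n, Module.Finite R (X.homology n) := by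
  have := isThick_homologyEventually (isFiniteModule R) (l := ⊤) fun _ ↦ Filter.tendsto_top
  convert this using 2 with X
  exact Filter.eventually_top.symm

end Thick

section FiniteProjectiveDimension

variable {R : Type u} [CommRing R] [IsNoetherianRing R]

theorem quasiIso_app_of_hasProjectiveDimensionLT {F G : ModuleCat.{u} R ⥤ Cplx R} (θ : F ⟶ G)
    (hF : ∀ {S : ShortComplex (ModuleCat.{u} R)}, S.ShortExact →
      DegreewiseExact (F.map S.f) (F.map S.g))
    (hG : ∀ {S : ShortComplex (ModuleCat.{u} R)}, S.ShortExact →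
      DegreewiseExact (G.map S.f) (G.map S.g))
    (hR : QuasiIso (θ.app (ModuleCat.of R R))) (M : ModuleCat.{u} R) [Module.Finite R M]
    {m : ℕ} [HasProjectiveDimensionLT M m] : QuasiIso (θ.app M) := by
  have h {S : ShortComplex (ModuleCat.{u} R)} (hS : S.ShortExact) :=
    (hF hS).quasiIso_two_of_three (hG hS) (θ.naturality S.f).symm (θ.naturality S.g).symm
  let C : ObjectProperty (ModuleCat.{u} R) := fun N ↦ QuasiIso (θ.app N)
  have : C.IsClosedUnderExtensions := ⟨fun hS h₁ h₃ ↦ (h hS).2.1 h₁ h₃⟩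
  have : C.IsStableUnderRetracts :=
    ⟨fun r (_ : QuasiIso _) ↦ quasiIso_of_retractArrow (NatTrans.retractArrowApp θ r)⟩
  exact prop_of_hasProjectiveDimensionLT C (fun hS ↦ (h hS).2.2) hR M (n := m)

theorem IsThick.prop_tensorModFunctor {𝒞 : ObjectProperty (Cplx R)} (h𝒞 : IsThick 𝒞) {P : Cplx R}
    (hP : ∀ n, Module.Flat R (P.X n)) (h : 𝒞 P) (M : ModuleCat.{u} R)
    [Module.Finite R M] {m : ℕ} [HasProjectiveDimensionLT M m] :
    𝒞 ((tensorModFunctor P).obj M) := by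
  have h₃ {S : ShortComplex (ModuleCat.{u} R)} (hS : S.ShortExact) :=
    h𝒞.two_of_three (degreewiseExact_tensorModFunctor hP hS)
  let C : ObjectProperty (ModuleCat.{u} R) := 𝒞.inverseImage (tensorModFunctor P)
  have : C.IsClosedUnderExtensions := ⟨fun hS ↦ (h₃ hS).2.1⟩
  have : C.IsStableUnderRetracts := ⟨fun r ↦ h𝒞.of_retract (r.map _)⟩
  exact prop_of_hasProjectiveDimensionLT C (fun hS ↦ (h₃ hS).2.2)
    (h𝒞.of_retract (.ofIso (tensorModFunctorObjSelf P)) h) M (n := m)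

theorem IsThick.prop_homModFunctor {𝒞 : ObjectProperty (Cplx R)} (h𝒞 : IsThick 𝒞) {I : Cplx R}
    (hI : ∀ n, Injective (I.X n)) (h : 𝒞 I) (M : ModuleCat.{u} R)
    [Module.Finite R M] {m : ℕ} [HasProjectiveDimensionLT M m] :
    𝒞 ((homModFunctor I).obj (.op M)) := by
  have h₃ {S : ShortComplex (ModuleCat.{u} R)} (hS : S.ShortExact) :=
    h𝒞.two_of_three (degreewiseExact_homModFunctor hI hS)
  let C : ObjectProperty (ModuleCat.{u} R) := (𝒞.inverseImage (homModFunctor I)).unop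
  have : C.IsClosedUnderExtensions := ⟨fun hS h₁ h₂ ↦ (h₃ hS).2.1 h₂ h₁⟩
  have : C.IsStableUnderRetracts := ⟨fun r ↦ h𝒞.of_retract (r.op.map _)⟩
  exact prop_of_hasProjectiveDimensionLT C (fun hS h₁ h₂ ↦ (h₃ hS).1 h₂ h₁)
    (h𝒞.of_retract (.ofIso (homModFunctorObjSelf I)) h) M (n := m)

end FiniteProjectiveDimension

section Pairings

variable {R : Type u} [CommRing R] {P I J : Cplx R}

/-- A morphism `u : P ⟶ Hom(I, J)` is perfect if it and the adjoint morphism `I ⊗ P ⟶ J` are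
quasi-isomorphisms. -/
structure IsPerfect (u : P ⟶ homComplex I J) : Prop where
  quasiIso : QuasiIso u
  quasiIso_untranspose : QuasiIso (untranspose u)

/-- The morphism `Hom(J, K) ⟶ Hom(P, Hom(I, K))` sending `z` to `y ↦ z ∘ u(y)`. -/
def pairingDual (u : P ⟶ homComplex I J) (K : Cplx R) :
    homComplex J K ⟶ homComplex P (homComplex I K) :=
  homComplexMapLeft (untranspose u) K ≫ curry I P K

theorem homApply_pairingDual (u : P ⟶ homComplex I J) {K : Cplx R} {n k m p q r : ℤ}
    (h : n + k = m) (hq : p + m = q) (hr : p + n = r) (hk : r + k = q)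
    (z : (homComplex J K).X k) (y : P.X n) (x : I.X p) :
    homApply hq (homApply h ((pairingDual u K).f k z) y) x =
      homApply hk z (homApply hr (u.f n y) x) := by
  refine (homApply_curry h hq hr hk ((homComplexMapLeft _ K).f k z) y x).trans ?_
  rw [homApply_homComplexMapLeft, untranspose_tmul, linearMap_units_smul, smul_smul,
    Int.units_mul_self, one_smul]

theorem quasiIso_pairingDual_characterComplex_iff (u : P ⟶ homComplex I J) :
    QuasiIso (pairingDual u (characterComplex R)) ↔ QuasiIso (untranspose u) := by
  rw [pairingDual, quasiIso_iff_comp_right]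
  exact ⟨quasiIso_of_homComplexMapLeft_characterComplex _,
    fun _ ↦ quasiIso_homComplexMapLeft _ _ inferInstance⟩

end Pairings

section ModulePairings

variable {R : Type u} [CommRing R] {P I J : Cplx R} (u : P ⟶ homComplex I J)

/-- The morphism `Hom(I, J) ⟶ Hom(Hom_R(M, I), Hom_R(M, J))` given by composition. -/
def homModComp (M : ModuleCat.{u} R) (I J : Cplx R) : homComplex I J ⟶
    homComplex ((homModFunctor I).obj (.op M)) ((homModFunctor J).obj (.op M)) where
  f n := ModuleCat.ofHom
    { toFun z := Cochain.map (K := I) (L := J) z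
        ((linearCoyoneda R (ModuleCat.{u} R)).obj (.op M))
      map_add' z z' := Cochain.map_add (K := I) (L := J) z z' _
      map_smul' r z := homApply_ext fun p q h (f : M ⟶ I.X p) ↦
        Linear.comp_smul (R := R) _ _ _ f r (Cochain.v (F := I) (G := J) z p q h) }
  comm' i j _ := by
    refine ModuleCat.hom_ext (LinearMap.ext fun z ↦ ?_)
    exact δ_map i j (K := I) (L := J) z
      ((linearCoyoneda R (ModuleCat.{u} R)).obj (.op M))

theorem pairingDual_homModComp_naturality (K : Cplx R) {M N : ModuleCat.{u} R} (f : M ⟶ N) :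
    homComplexMapLeft ((homModFunctor J).map f.op) K ≫ pairingDual (u ≫ homModComp N I J) K =
      pairingDual (u ≫ homModComp M I J) K ≫
        homComplexMapRight P (homComplexMapLeft ((homModFunctor I).map f.op) K) := by
  refine homComplex_hom_ext fun k n m h z y ↦ homApply_ext fun p q hq g ↦ ?_
  simp only [HomologicalComplex.comp_f, ModuleCat.comp_apply]
  rw [homApply_pairingDual _ h hq rfl (by lia), homApply_homComplexMapLeft,
    homApply_homComplexMapRight, homApply_homComplexMapLeft,
    homApply_pairingDual _ h hq rfl (by lia)]
  exact congrArg (homApply _ z) (Category.assoc f g _).symm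

/-- The natural morphism `Hom(Hom_R(M, J), K) ⟶ Hom(P, Hom(Hom_R(M, I), K))` induced by
`P ⟶ Hom(I, J)`, as a transformation of functors of `M`. -/
def homModPairingDual (K : Cplx R) :
    (homModFunctor J).rightOp ⋙ homComplexFunctorLeft K ⟶
      (homModFunctor I).rightOp ⋙ homComplexFunctorLeft K ⋙ homComplexFunctorRight P where
  app M := pairingDual (u ≫ homModComp M I J) K
  naturality _ _ f := pairingDual_homModComp_naturality u K f

theorem homModFunctorObjSelf_hom_f (I : Cplx R) (n : ℤ) (f : ModuleCat.of R R ⟶ I.X n) :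
    (homModFunctorObjSelf I).hom.f n f = f (1 : R) := rfl

theorem quasiIso_pairingDual_homModComp_self {K : Cplx R} (h : QuasiIso (pairingDual u K)) :
    QuasiIso (pairingDual (u ≫ homModComp (ModuleCat.of R R) I J) K) := by
  have e : homComplexMapLeft (homModFunctorObjSelf J).hom K ≫
        pairingDual (u ≫ homModComp (ModuleCat.of R R) I J) K =
      pairingDual u K ≫
        homComplexMapRight P (homComplexMapLeft (homModFunctorObjSelf I).hom K) := by
    refine homComplex_hom_ext fun k n m h z y ↦ homApply_ext fun p q hq f ↦ ?_
    simp only [HomologicalComplex.comp_f, ModuleCat.comp_apply]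
    rw [homApply_pairingDual _ h hq rfl (by lia), homApply_homComplexMapRight,
      homApply_homComplexMapLeft, homApply_homComplexMapLeft,
      homApply_pairingDual _ h hq rfl (by lia)]
    rfl
  have (X : Cplx R) : IsIso (homComplexMapLeft (homModFunctorObjSelf X).hom K) :=
    inferInstanceAs (IsIso ((homComplexFunctorLeft K).map (homModFunctorObjSelf X).hom.op))
  have : IsIso (homComplexMapRight P (homComplexMapLeft (homModFunctorObjSelf I).hom K)) :=
    inferInstanceAs (IsIso ((homComplexFunctorRight P).map _))
  rw [← quasiIso_iff_comp_left (homComplexMapLeft (homModFunctorObjSelf J).hom K), e]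
  infer_instance

theorem quasiIso_pairingDual_homModComp [IsNoetherianRing R] {K : Cplx R}
    (hP : ∀ n, Projective (P.X n)) (hI : ∀ n, Injective (I.X n)) (hJ : ∀ n, Injective (J.X n))
    (hK : ∀ n, Injective (K.X n)) (h : QuasiIso (pairingDual u K)) (M : ModuleCat.{u} R)
    [Module.Finite R M] {m : ℕ} [HasProjectiveDimensionLT M m] :
    QuasiIso (pairingDual (u ≫ homModComp M I J) K) :=
  quasiIso_app_of_hasProjectiveDimensionLT (homModPairingDual u K)
    (fun hS ↦ (degreewiseExact_homModFunctor hJ hS).homComplexMapLeft K hK)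
    (fun hS ↦
      ((degreewiseExact_homModFunctor hI hS).homComplexMapLeft K hK).homComplexMapRight P hP)
    (quasiIso_pairingDual_homModComp_self u h) M (m := m)

end ModulePairings

section TensorPairings

variable {R : Type u} [CommRing R] {P I J : Cplx R}

/-- The pure tensors of the complex `M ⊗_R P`. -/
def modTmul (M : ModuleCat.{u} R) (P : Cplx R) (n : ℤ) :
    M →ₗ[R] P.X n →ₗ[R] ((tensorModFunctor P).obj M).X n :=
  TensorProduct.mk R M (P.X n)

theorem tensorModFunctor_hom_ext {M : ModuleCat.{u} R} {Z : Cplx R}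
    {f g : (tensorModFunctor P).obj M ⟶ Z}
    (H : ∀ n a y, f.f n (modTmul M P n a y) = g.f n (modTmul M P n a y)) : f = g := by
  ext n : 1
  exact ModuleCat.hom_ext (TensorProduct.ext' (H n))

theorem tensorModFunctorObjSelf_hom_modTmul (P : Cplx R) {n : ℤ} (r : R) (y : P.X n) :
    (tensorModFunctorObjSelf P).hom.f n (modTmul (ModuleCat.of R R) P n r y) = r • y := rfl

/-- Morphisms out of `M ⊗_R P`, from linear families of morphisms out of `P`. -/
def tensorModLift {M : ModuleCat.{u} R} {Z : Cplx R} (v : M →ₗ[R] (P ⟶ Z)) :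
    (tensorModFunctor P).obj M ⟶ Z where
  f n := ModuleCat.ofHom <| TensorProduct.lift <| LinearMap.mk₂ R (fun a y ↦ (v a).f n y)
    (fun a a' y ↦ by rw [map_add]; rfl) (fun r a y ↦ by rw [map_smul]; rfl)
    (fun a y y' ↦ map_add _ y y') (fun r a y ↦ map_smul _ r y)
  comm' n n' _ :=
    ModuleCat.hom_ext <| TensorProduct.ext' fun a y ↦ (comm_apply (v a) n n' y).symm

/-- Evaluation at an element of `M`, as a morphism `Hom_R(M, I) ⟶ I`. -/
def homModEval {M : ModuleCat.{u} R} (I : Cplx R) :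
    M →ₗ[R] ((homModFunctor I).obj (.op M) ⟶ I) where
  toFun a :=
    { f n := ModuleCat.ofHom (LinearMap.applyₗ a ∘ₗ
        (ModuleCat.homLinearEquiv (S := R) (M := M) (N := I.X n)).toLinearMap) }
  map_add' a a' := by
    ext n (f : M ⟶ I.X n)
    exact map_add f.hom a a'
  map_smul' r a := by
    ext n (f : M ⟶ I.X n)
    exact map_smul f.hom r a

variable (u : P ⟶ homComplex I J)

theorem homApply_comp_homModEval {M : ModuleCat.{u} R} {n p q : ℤ} (h : p + n = q) (a : M)
    (y : P.X n) (f : M ⟶ I.X p) :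
    homApply h ((u ≫ homComplexMapLeft (homModEval I a) J).f n y) f = homApply h (u.f n y) (f a) :=
  homApply_homComplexMapLeft (homModEval I a) h (u.f n y) f

/-- The morphism `M ⊗ P ⟶ Hom(Hom_R(M, I), J)` sending `m ⊗ y` to `f ↦ u(y)(f(m))`. -/
def tensorModPairing (M : ModuleCat.{u} R) :
    (tensorModFunctor P).obj M ⟶ homComplex ((homModFunctor I).obj (.op M)) J :=
  tensorModLift
    { toFun a := u ≫ homComplexMapLeft (homModEval I a) J
      map_add' a a' := homComplex_hom_ext fun n p q h y (f : M ⟶ I.X p) ↦ by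
        refine (homApply_comp_homModEval u h (a + a') y f).trans ?_
        rw [map_add, map_add]
        exact (congrArg₂ (· + ·) (homApply_comp_homModEval u h a y f)
          (homApply_comp_homModEval u h a' y f)).symm
      map_smul' r a := homComplex_hom_ext fun n p q h y (f : M ⟶ I.X p) ↦ by
        refine (homApply_comp_homModEval u h (r • a) y f).trans ?_
        rw [map_smul, map_smul]
        exact (congrArg (r • ·) (homApply_comp_homModEval u h a y f)).symm }

theorem homApply_tensorModPairing {M : ModuleCat.{u} R} {n p q : ℤ} (h : p + n = q) (a : M)
    (y : P.X n) (f : M ⟶ I.X p) :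
    homApply h ((tensorModPairing u M).f n (modTmul M P n a y)) f = homApply h (u.f n y) (f a) :=
  homApply_comp_homModEval u h a y f

/-- `tensorModPairing u` as a transformation of functors of the module. -/
def tensorModPairingNatTrans :
    tensorModFunctor P ⟶ (homModFunctor I).rightOp ⋙ homComplexFunctorLeft J where
  app := tensorModPairing u
  naturality _ N f := tensorModFunctor_hom_ext fun _ a y ↦ homApply_ext fun p _ h (g : N ⟶ I.X p) ↦
    ((homApply_tensorModPairing u h (f a) y g).trans
      (homApply_tensorModPairing u h a y (f ≫ g)).symm).trans
      (homApply_homComplexMapLeft ((homModFunctor I).map f.op) h _ g).symm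

theorem tensorModPairing_self :
    tensorModPairing u (ModuleCat.of R R) = (tensorModFunctorObjSelf P).hom ≫
      u ≫ homComplexMapLeft (homModFunctorObjSelf I).hom J := by
  refine tensorModFunctor_hom_ext fun n r y ↦
    homApply_ext fun p q h (f : ModuleCat.of R R ⟶ I.X p) ↦ ?_
  have hf : r • f (1 : R) = f r := by rw [← map_smul, smul_eq_mul, mul_one]
  simp only [HomologicalComplex.comp_f, ModuleCat.comp_apply]
  rw [tensorModFunctorObjSelf_hom_modTmul]
  refine (homApply_tensorModPairing u h r y f).trans
    (Eq.trans ?_ (homApply_homComplexMapLeft (homModFunctorObjSelf I).hom h (u.f n (r • y)) f).symm)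
  rw [homModFunctorObjSelf_hom_f, map_smul, map_smul, LinearMap.smul_apply, ← map_smul, hf]

theorem quasiIso_tensorModPairing [IsNoetherianRing R] (hP : ∀ n, Module.Flat R (P.X n))
    (hI : ∀ n, Injective (I.X n)) (hJ : ∀ n, Injective (J.X n)) [QuasiIso u] (M : ModuleCat.{u} R)
    [Module.Finite R M] {m : ℕ} [HasProjectiveDimensionLT M m] :
    QuasiIso (tensorModPairing u M) := by
  refine quasiIso_app_of_hasProjectiveDimensionLT (tensorModPairingNatTrans u)
    (degreewiseExact_tensorModFunctor hP)
    (fun hS ↦ (degreewiseExact_homModFunctor hI hS).homComplexMapLeft J hJ) ?_ M (m := m)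
  have : IsIso (homComplexMapLeft (homModFunctorObjSelf I).hom J) :=
    inferInstanceAs (IsIso ((homComplexFunctorLeft J).map (homModFunctorObjSelf I).hom.op))
  change QuasiIso (tensorModPairing u (ModuleCat.of R R))
  rw [tensorModPairing_self]
  infer_instance

end TensorPairings

section ChangeOfRings

variable {R S : Type u} [CommRing R] [CommRing S] (φ : R →+* S)

/-- `S` as an `R`-module. -/
abbrev target : ModuleCat.{u} R := (ModuleCat.restrictScalars φ).obj (ModuleCat.of S S)

/-- Restriction of scalars of complexes. -/
abbrev res : Cplx S ⥤ Cplx R :=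
  (ModuleCat.restrictScalars.{u} φ).mapHomologicalComplex (ComplexShape.up ℤ)

/-- Extension of scalars of complexes, `S ⊗_R -`. -/
abbrev ext : Cplx R ⥤ Cplx S :=
  (ModuleCat.extendScalars.{u, u, u} φ).mapHomologicalComplex (ComplexShape.up ℤ)

/-- Coextension of scalars of complexes, `Hom_R(S, -)`. -/
abbrev coext : Cplx R ⥤ Cplx S :=
  (ModuleCat.coextendScalars.{u, u, u} φ).mapHomologicalComplex (ComplexShape.up ℤ)

/-- The unit of the adjunction between extension and restriction of scalars. -/
def extUnit (P : Cplx R) : P ⟶ (res φ).obj ((ext φ).obj P) where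
  f n := (ModuleCat.extendRestrictScalarsAdj φ).unit.app (P.X n)
  comm' i j _ := ((ModuleCat.extendRestrictScalarsAdj φ).unit.naturality (P.d i j)).symm

/-- The counit of the adjunction between extension and restriction of scalars. -/
def extCounit (Z : Cplx S) : (ext φ).obj ((res φ).obj Z) ⟶ Z where
  f n := (ModuleCat.extendRestrictScalarsAdj φ).counit.app (Z.X n)
  comm' i j _ := ((ModuleCat.extendRestrictScalarsAdj φ).counit.naturality (Z.d i j)).symm

/-- The counit of the adjunction between restriction and coextension of scalars, that is evaluation
at `1`. -/
def coextCounit (I : Cplx R) : (res φ).obj ((coext φ).obj I) ⟶ I where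
  f n := (ModuleCat.restrictCoextendScalarsAdj φ).counit.app (I.X n)
  comm' i j _ := ((ModuleCat.restrictCoextendScalarsAdj φ).counit.naturality (I.d i j)).symm

/-- Restriction of scalars of homomorphisms. -/
def resMap (X Y : Cplx S) :
    (res φ).obj (homComplex X Y) ⟶ homComplex ((res φ).obj X) ((res φ).obj Y) where
  f n := ModuleCat.ofHom (X := ((res φ).obj (homComplex X Y)).X n)
    { toFun z := Cochain.map (K := X) (L := Y) z (ModuleCat.restrictScalars.{u} φ)
      map_add' z z' := Cochain.map_add (K := X) (L := Y) z z' _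
      map_smul' r z := rfl }
  comm' i j _ := by
    refine ModuleCat.hom_ext (LinearMap.ext fun z ↦ ?_)
    exact δ_map i j (K := X) (L := Y) z (ModuleCat.restrictScalars.{u} φ)

variable {φ}

/-- The element `s ⊗ y` of `S ⊗_R P`. -/
def extTmul {P : Cplx R} {n : ℤ} (s : S) (y : P.X n) : ((ext φ).obj P).X n :=
  ((show target φ from s) ⊗ₜ[R] y : target φ ⊗[R] P.X n)

theorem extTmul_eq_smul {P : Cplx R} {n : ℤ} (s : S) (y : P.X n) :
    extTmul (φ := φ) s y = s • extTmul (φ := φ) (1 : S) y :=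
  congrArg (extTmul · y) (mul_one s).symm

/-- The linear map underlying an element of `Hom_R(S, I)`. -/
def coextApp {I : Cplx R} {n : ℤ} (f : ((coext φ).obj I).X n) : target φ →ₗ[R] I.X n := f

theorem coextApp_smul {I : Cplx R} {n : ℤ} (f : ((coext φ).obj I).X n) (s t : S) :
    coextApp (s • f) t = coextApp f (t * s : S) := rfl

theorem coextApp_mul_map {I : Cplx R} {n : ℤ} (f : ((coext φ).obj I).X n) (s : S) (r : R) :
    coextApp f (s * φ r : S) = r • coextApp f s :=
  (congrArg (coextApp f) (mul_comm s (φ r))).trans (map_smul (coextApp f) r (show target φ from s))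

variable (φ)

/-- The morphism `Hom_R(I, J) ⟶ Hom_S(Hom_R(S, I), Hom_R(S, J))` given by composition. -/
def coextMap (I J : Cplx R) :
    homComplex I J ⟶ (res φ).obj (homComplex ((coext φ).obj I) ((coext φ).obj J)) where
  f n := ModuleCat.ofHom (Y := ((res φ).obj (homComplex ((coext φ).obj I) ((coext φ).obj J))).X n)
    { toFun z := Cochain.map (K := I) (L := J) z (ModuleCat.coextendScalars.{u, u, u} φ)
      map_add' z z' := Cochain.map_add (K := I) (L := J) z z' _
      map_smul' r z := homApply_ext fun p q h f ↦ LinearMap.ext fun (s : S) ↦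
        (map_smul (homApply h z) r _).symm.trans
          (congrArg (homApply h z) (coextApp_mul_map f s r).symm) }
  comm' i j _ := by
    refine ModuleCat.hom_ext (LinearMap.ext fun z ↦ ?_)
    exact δ_map i j (K := I) (L := J) z (ModuleCat.coextendScalars.{u, u, u} φ)

variable {φ}

theorem bijective_of_homComplex_components {X Y : Cplx R} {X' Y' : Cplx S} {n : ℤ}
    (F : (homComplex X Y).X n → (homComplex X' Y').X n)
    (e : ∀ p q : ℤ, p + n = q → (X.X p ⟶ Y.X q) ≃ (X'.X p ⟶ Y'.X q))
    (hF : ∀ z p q h,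
      ModuleCat.ofHom (homApply h (F z)) = e p q h (ModuleCat.ofHom (homApply h z))) :
    Function.Bijective F := by
  refine ⟨fun z z' hz ↦ homApply_ext fun p q h ↦ LinearMap.congr_fun ?_, fun w ↦
    ⟨homMk fun p q h ↦ ((e p q h).symm (ModuleCat.ofHom (homApply h w))).hom,
      homApply_ext fun p q h ↦ LinearMap.congr_fun ?_⟩⟩
  · have he := (hF z p q h).symm.trans (hz ▸ hF z' p q h)
    exact congrArg ModuleCat.Hom.hom ((e p q h).injective he)
  · exact congrArg ModuleCat.Hom.hom ((hF _ p q h).trans ((e p q h).apply_symm_apply _))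

variable (φ)

/-- The morphism `Hom_S(E, Hom_R(S, Z)) ⟶ Hom_R(E, Z)` given by evaluation at `1`. -/
def resHomCoext (E : Cplx S) (Z : Cplx R) :
    (res φ).obj (homComplex E ((coext φ).obj Z)) ⟶ homComplex ((res φ).obj E) Z :=
  resMap φ E ((coext φ).obj Z) ≫ homComplexMapRight _ (coextCounit φ Z)

/-- The morphism `Hom_S(S ⊗_R P, Z) ⟶ Hom_R(P, Z)` given by restriction to `P`. -/
def resHomExt (P : Cplx R) (Z : Cplx S) :
    (res φ).obj (homComplex ((ext φ).obj P) Z) ⟶ homComplex P ((res φ).obj Z) :=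
  resMap φ ((ext φ).obj P) Z ≫ homComplexMapLeft (extUnit φ P) _

variable {φ}

theorem homApply_resHomCoext {E : Cplx S} {Z : Cplx R} {n p q : ℤ} (h : p + n = q)
    (z : (homComplex E ((coext φ).obj Z)).X n) (e : E.X p) :
    homApply (X := (res φ).obj E) h ((resHomCoext φ E Z).f n z) e =
      coextApp (homApply h z e) (1 : S) :=
  homApply_homComplexMapRight (coextCounit φ Z) h _ _

theorem homApply_resHomExt {P : Cplx R} {Z : Cplx S} {n p q : ℤ} (h : p + n = q)
    (z : (homComplex ((ext φ).obj P) Z).X n) (y : P.X p) :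
    homApply h ((resHomExt φ P Z).f n z) y = homApply h z (extTmul 1 y) :=
  homApply_homComplexMapLeft (extUnit φ P) h _ _

instance (E : Cplx S) (Z : Cplx R) : QuasiIso (resHomCoext φ E Z) :=
  quasiIso_of_bijective _ fun _ ↦ bijective_of_homComplex_components _
    (fun _ _ _ ↦ ((ModuleCat.restrictCoextendScalarsAdj φ).homEquiv _ _).symm)
    fun z _ _ h ↦ ModuleCat.hom_ext (LinearMap.ext (homApply_resHomCoext h z))

instance (P : Cplx R) (Z : Cplx S) : QuasiIso (resHomExt φ P Z) :=
  quasiIso_of_bijective _ fun _ ↦ bijective_of_homComplex_components _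
    (fun _ _ _ ↦ (ModuleCat.extendRestrictScalarsAdj φ).homEquiv _ _)
    fun z _ _ h ↦ ModuleCat.hom_ext (LinearMap.ext (homApply_resHomExt h z))

end ChangeOfRings

section CobaseChangePairing

variable {R S : Type u} [CommRing R] [CommRing S] (φ : R →+* S)

/-- The identification of the `R`-complex underlying `Hom_R(S, I)`. -/
def fromResCoext (I : Cplx R) :
    (res φ).obj ((coext φ).obj I) ⟶ (homModFunctor I).obj (.op (target φ)) where
  f n := ModuleCat.ofHom (X := ((res φ).obj ((coext φ).obj I)).X n)
      (Y := ((homModFunctor I).obj (.op (target φ))).X n)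
    { toFun f := ModuleCat.ofHom (X := target φ) (coextApp f)
      map_add' _ _ := rfl
      map_smul' r f := ModuleCat.hom_ext (LinearMap.ext fun s ↦ coextApp_mul_map f s r) }
  comm' _ _ _ := rfl

theorem ext_smul_eq {P : Cplx R} {n : ℤ} (r : R) (t : target φ ⊗[R] P.X n) :
    (show ((res φ).obj ((ext φ).obj P)).X n from (r • t : target φ ⊗[R] P.X n)) =
      r • (show ((res φ).obj ((ext φ).obj P)).X n from t) := by
  induction t using TensorProduct.induction_on with
  | zero =>
    exact (smul_zero (A := target φ ⊗[R] P.X n) r).trans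
      (smul_zero (A := ((res φ).obj ((ext φ).obj P)).X n) r).symm
  | tmul => rfl
  | add t t' h h' =>
    exact (smul_add (A := target φ ⊗[R] P.X n) r t t').trans ((congrArg₂ (· + ·) h h').trans
      (smul_add (A := ((res φ).obj ((ext φ).obj P)).X n) r t t').symm)

/-- The identification of the `R`-complex underlying `S ⊗_R P`. -/
def toResExt (P : Cplx R) : (tensorModFunctor P).obj (target φ) ⟶ (res φ).obj ((ext φ).obj P) where
  f n := ModuleCat.ofHom (X := ((tensorModFunctor P).obj (target φ)).X n)
      (Y := ((res φ).obj ((ext φ).obj P)).X n)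
    { toFun t := t
      map_add' _ _ := rfl
      map_smul' := ext_smul_eq φ }
  comm' _ _ _ := ModuleCat.hom_ext (TensorProduct.ext' fun _ _ ↦ rfl)

instance (I : Cplx R) : QuasiIso (fromResCoext φ I) :=
  quasiIso_of_bijective _ fun _ ↦ ⟨fun _ _ h ↦ congrArg (ModuleCat.Hom.hom (A := target φ)) h,
    fun f ↦ ⟨ModuleCat.Hom.hom (A := target φ) f, rfl⟩⟩

instance (P : Cplx R) : QuasiIso (toResExt φ P) :=
  quasiIso_of_bijective _ fun _ ↦ Function.bijective_id

theorem toResExt_modTmul {P : Cplx R} {n : ℤ} (s : S) (y : P.X n) :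
    (toResExt φ P).f n (modTmul (target φ) P n s y) = extTmul (φ := φ) s y := rfl

variable {P I J : Cplx R} (u : P ⟶ homComplex I J)

/-- The pairing `S ⊗_R P ⟶ Hom_S(Hom_R(S, I), Hom_R(S, J))` induced by `P ⟶ Hom_R(I, J)`. -/
def cobasePairing : (ext φ).obj P ⟶ homComplex ((coext φ).obj I) ((coext φ).obj J) :=
  (ext φ).map (u ≫ coextMap φ I J) ≫ extCounit φ _

theorem cobasePairing_one_extTmul {n : ℤ} (y : P.X n) :
    (cobasePairing φ u).f n (extTmul 1 y) = (coextMap φ I J).f n (u.f n y) :=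
  one_smul S (show (homComplex ((coext φ).obj I) ((coext φ).obj J)).X n from _)

theorem quasiIso_res_map_iff {X Y : Cplx S} (f : X ⟶ Y) :
    QuasiIso ((res φ).map f) ↔ QuasiIso f := by
  rw [quasiIso_iff_coneExact, quasiIso_iff_coneExact]
  exact Iff.rfl

theorem homApply_cobasePairing_extTmul {n p q : ℤ} (h : p + n = q) (s t : S) (y : P.X n)
    (f : ((coext φ).obj I).X p) :
    coextApp (homApply (X := (coext φ).obj I) (Y := (coext φ).obj J) h
        ((cobasePairing φ u).f n (extTmul s y)) f) t =
      homApply h (u.f n y) (coextApp f (t * s : S)) := by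
  rw [extTmul_eq_smul, map_smul, map_smul, LinearMap.smul_apply, coextApp_smul]
  exact congrArg (fun w ↦ coextApp (homApply (X := (coext φ).obj I) (Y := (coext φ).obj J) h w f)
    (t * s : S)) (cobasePairing_one_extTmul φ u y)

theorem homApply_resHomCoext_cobasePairing {n p q : ℤ} (h : p + n = q) (s : S) (y : P.X n)
    (f : ((coext φ).obj I).X p) :
    homApply (X := (res φ).obj ((coext φ).obj I)) h ((resHomCoext φ ((coext φ).obj I) J).f n
      ((cobasePairing φ u).f n (extTmul s y))) f = homApply h (u.f n y) (coextApp f s) := by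
  refine (homApply_resHomCoext h _ f).trans ?_
  refine (homApply_cobasePairing_extTmul φ u h s 1 y f).trans ?_
  rw [one_mul]

theorem homApply_fromResCoext_tensorModPairing {n p q : ℤ} (h : p + n = q) (s : S) (y : P.X n)
    (f : ((coext φ).obj I).X p) :
    homApply (X := (res φ).obj ((coext φ).obj I)) h ((homComplexMapLeft (fromResCoext φ I) J).f n
        ((tensorModPairing u (target φ)).f n (modTmul (target φ) P n s y))) f =
      homApply h (u.f n y) (coextApp f s) := by
  refine (homApply_homComplexMapLeft (fromResCoext φ I) h
    ((tensorModPairing u (target φ)).f n (modTmul (target φ) P n s y)) f).trans ?_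
  exact homApply_tensorModPairing (M := target φ) u h s y
    (ModuleCat.ofHom (X := target φ) (coextApp f))

theorem toResExt_comp_cobasePairing :
    toResExt φ P ≫ (res φ).map (cobasePairing φ u) ≫ resHomCoext φ ((coext φ).obj I) J =
      tensorModPairing u (target φ) ≫ homComplexMapLeft (fromResCoext φ I) J := by
  refine tensorModFunctor_hom_ext fun n (s : S) y ↦ homApply_ext fun p q h f ↦ ?_
  refine Eq.trans ?_ (homApply_fromResCoext_tensorModPairing φ u h s y f).symm
  refine Eq.trans ?_ (homApply_resHomCoext_cobasePairing φ u h s y f)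
  rw [← toResExt_modTmul]
  rfl

theorem homComplexMapLeft_fromResCoext_comp_pairingDual (K : Cplx R) :
    homComplexMapLeft (fromResCoext φ J) K ≫
        pairingDual (u ≫ coextMap φ I J ≫ resMap φ _ _) K =
      pairingDual (u ≫ homModComp (target φ) I J) K ≫
        homComplexMapRight P (homComplexMapLeft (fromResCoext φ I) K) := by
  refine homComplex_hom_ext fun k n m h z y ↦ homApply_ext fun p q hq f ↦ ?_
  simp only [HomologicalComplex.comp_f, ModuleCat.comp_apply]
  rw [homApply_pairingDual _ h hq rfl (by lia), homApply_homComplexMapLeft,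
    homApply_homComplexMapRight, homApply_homComplexMapLeft,
    homApply_pairingDual _ h hq rfl (by lia)]
  rfl

theorem homApply_pairingDual_cobasePairing {K : Cplx R} {n k m p q r : ℤ}
    (h : n + k = m) (hq : p + m = q) (hr : p + n = r) (hk : r + k = q)
    (z : (homComplex ((coext φ).obj J) ((coext φ).obj K)).X k) (y : P.X n)
    (f : ((coext φ).obj I).X p) :
    homApply (X := (res φ).obj ((coext φ).obj I)) hq (homApply h
        ((homComplexMapRight P (resHomCoext φ ((coext φ).obj I) K)).f k ((resHomExt φ P _).f k
          ((pairingDual (cobasePairing φ u) ((coext φ).obj K)).f k z))) y) f =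
      coextApp (homApply hk z (homApply (X := (coext φ).obj I) (Y := (coext φ).obj J) hr
        ((coextMap φ I J).f n (u.f n y)) f)) (1 : S) := by
  rw [homApply_homComplexMapRight]
  refine (homApply_resHomCoext hq _ f).trans ?_
  refine (congrArg (fun w ↦ coextApp (homApply (X := (coext φ).obj I) (Y := (coext φ).obj K) hq w f)
    (1 : S)) (homApply_resHomExt h _ y)).trans ?_
  rw [homApply_pairingDual _ h hq hr hk]
  exact congrArg (fun w ↦ coextApp (homApply hk z (homApply (X := (coext φ).obj I)
    (Y := (coext φ).obj J) hr w f)) (1 : S)) (cobasePairing_one_extTmul φ u y)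

theorem pairingDual_cobasePairing_comp (K : Cplx R) :
    (res φ).map (pairingDual (cobasePairing φ u) ((coext φ).obj K)) ≫ resHomExt φ P _ ≫
        homComplexMapRight P (resHomCoext φ ((coext φ).obj I) K) =
      resHomCoext φ ((coext φ).obj J) K ≫
        pairingDual (u ≫ coextMap φ I J ≫ resMap φ _ _) K := by
  refine homComplex_hom_ext fun k n m h z y ↦ homApply_ext fun p q hq f ↦ ?_
  refine (homApply_pairingDual_cobasePairing φ u h hq rfl (by lia) z y f).trans ?_
  simp only [HomologicalComplex.comp_f, ModuleCat.comp_apply]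
  rw [homApply_pairingDual _ h hq rfl (by lia)]
  exact (homApply_resHomCoext _ z _).symm

theorem res_map_homComplexMapLeft_comp {E F : Cplx S} (f : E ⟶ F) (K : Cplx R) :
    (res φ).map (homComplexMapLeft f ((coext φ).obj K)) ≫ resHomCoext φ E K =
      resHomCoext φ F K ≫ homComplexMapLeft ((res φ).map f) K := by
  refine homComplex_hom_ext fun n p q h z x ↦ ?_
  refine (homApply_resHomCoext h ((homComplexMapLeft f ((coext φ).obj K)).f n z) x).trans ?_
  refine Eq.trans ?_
    (homApply_homComplexMapLeft ((res φ).map f) h ((resHomCoext φ F K).f n z) x).symm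
  refine Eq.trans ?_ (homApply_resHomCoext h z (f.f p x)).symm
  exact congrArg (coextApp · (1 : S)) (homApply_homComplexMapLeft f h _ x)

theorem quasiIso_pairingDual_cobasePairing [IsNoetherianRing R] {K : Cplx R} [P.IsKProjective]
    [K.IsKInjective] (hP : ∀ n, Projective (P.X n)) (hI : ∀ n, Injective (I.X n))
    (hJ : ∀ n, Injective (J.X n)) (hK : ∀ n, Injective (K.X n)) (h : QuasiIso (pairingDual u K))
    [Module.Finite R (target φ)] {m : ℕ} [HasProjectiveDimensionLT (target φ) m] :
    QuasiIso (pairingDual (cobasePairing φ u) ((coext φ).obj K)) := by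
  have := quasiIso_pairingDual_homModComp u hP hI hJ hK h (target φ) (m := m)
  have (X : Cplx R) : QuasiIso (homComplexMapLeft (fromResCoext φ X) K) :=
    quasiIso_homComplexMapLeft _ _ inferInstance
  have := quasiIso_homComplexMapRight P (resHomCoext φ ((coext φ).obj I) K) inferInstance
  have := quasiIso_homComplexMapRight P (homComplexMapLeft (fromResCoext φ I) K) inferInstance
  rw [← quasiIso_res_map_iff φ, ← quasiIso_iff_comp_right _ (resHomExt φ P _ ≫
      homComplexMapRight P (resHomCoext φ ((coext φ).obj I) K)),
    pairingDual_cobasePairing_comp, quasiIso_iff_comp_left,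
    ← quasiIso_iff_comp_left (homComplexMapLeft (fromResCoext φ J) K),
    homComplexMapLeft_fromResCoext_comp_pairingDual]
  infer_instance

theorem quasiIso_of_homComplexMapLeft_coext_characterComplex {E F : Cplx S} (f : E ⟶ F)
    (hf : QuasiIso (homComplexMapLeft f ((coext φ).obj (characterComplex R)))) : QuasiIso f := by
  rw [← quasiIso_res_map_iff φ]
  refine quasiIso_of_homComplexMapLeft_characterComplex _ ?_
  have := (quasiIso_res_map_iff φ _).2 hf
  rw [← quasiIso_iff_comp_left (resHomCoext φ F _), ← res_map_homComplexMapLeft_comp]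
  infer_instance

theorem quasiIso_cobasePairing [IsNoetherianRing R] [J.IsKInjective]
    (hP : ∀ n, Module.Flat R (P.X n)) (hI : ∀ n, Injective (I.X n)) (hJ : ∀ n, Injective (J.X n))
    [QuasiIso u] [Module.Finite R (target φ)] {m : ℕ} [HasProjectiveDimensionLT (target φ) m] :
    QuasiIso (cobasePairing φ u) := by
  have := quasiIso_tensorModPairing u hP hI hJ (target φ) (m := m)
  have := quasiIso_homComplexMapLeft (fromResCoext φ I) J inferInstance
  rw [← quasiIso_res_map_iff φ, ← quasiIso_iff_comp_right _ (resHomCoext φ _ J),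
    ← quasiIso_iff_comp_left (toResExt φ P), toResExt_comp_cobasePairing]
  infer_instance

variable {u}

theorem isPerfect_cobasePairing [IsNoetherianRing R] (hu : IsPerfect u) [P.IsKProjective]
    [J.IsKInjective] (hP : ∀ n, Projective (P.X n)) (hI : ∀ n, Injective (I.X n))
    (hJ : ∀ n, Injective (J.X n)) [Module.Finite R (target φ)] {m : ℕ}
    [HasProjectiveDimensionLT (target φ) m] : IsPerfect (cobasePairing φ u) where
  quasiIso := by
    have := hu.quasiIso
    exact quasiIso_cobasePairing φ u (fun n ↦ Module.Flat.of_projective (M := P.X n)) hI hJ (m := m)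
  quasiIso_untranspose := by
    refine quasiIso_of_homComplexMapLeft_coext_characterComplex φ _ ?_
    rw [← quasiIso_iff_comp_right _ (curry ((coext φ).obj I) ((ext φ).obj P) _)]
    exact quasiIso_pairingDual_cobasePairing φ u hP hI hJ injective_characterComplex
      ((quasiIso_pairingDual_characterComplex_iff u).2 hu.quasiIso_untranspose) (m := m)

end CobaseChangePairing

section Adjunction

variable {R : Type u} [CommRing R]

theorem untranspose_comp_homComplexMapLeft {Q I P J : Cplx R} (f : Q ⟶ I)
    (u : P ⟶ homComplex I J) :
    untranspose (u ≫ homComplexMapLeft f J) = tensorMap f (𝟙 P) ≫ untranspose u := by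
  refine tensorComplex_ext fun p n q h x y ↦ ?_
  rw [untranspose_tmul, HomologicalComplex.comp_f, ModuleCat.comp_apply, HomologicalComplex.comp_f,
    ModuleCat.comp_apply, tensorMap_tmul, homApply_homComplexMapLeft]
  exact (untranspose_tmul u h (f.f p x) y).symm

theorem toHomTensor_naturality (Q : Cplx R) {X Y : Cplx R} (f : X ⟶ Y) :
    toHomTensor Q X ≫ homComplexMapRight Q (tensorMap (𝟙 Q) f) = f ≫ toHomTensor Q Y := by
  refine homComplex_hom_ext fun n p q h x y ↦ ?_
  simp only [HomologicalComplex.comp_f, ModuleCat.comp_apply]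
  rw [homApply_homComplexMapRight, homApply_toHomTensor, homApply_toHomTensor, map_units_smul,
    tensorMap_tmul]
  rfl

theorem tensorHomEval_naturality (Q : Cplx R) {X Y : Cplx R} (f : X ⟶ Y) :
    tensorMap (𝟙 Q) (homComplexMapRight Q f) ≫ tensorHomEval Q Y = tensorHomEval Q X ≫ f := by
  refine tensorComplex_ext fun p n q h y z ↦ ?_
  simp only [HomologicalComplex.comp_f, ModuleCat.comp_apply]
  rw [tensorMap_tmul, tensorHomEval_tmul, tensorHomEval_tmul, map_units_smul]
  exact congrArg _ (homApply_homComplexMapRight f h z y)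

theorem quasiIso_toHomTensor_iff_of_quasiIso {X Y : Cplx R} (f : X ⟶ Y) [QuasiIso f] {Q : Cplx R}
    (hQ : ∀ n, Projective (Q.X n)) {b : ℤ} [Q.IsStrictlyLE b] :
    QuasiIso (toHomTensor Q X) ↔ QuasiIso (toHomTensor Q Y) := by
  have := CochainComplex.isKProjective_of_projective Q b
  have := quasiIso_tensorMap_id_left (fun n ↦ Module.Flat.of_projective (M := Q.X n)) b f ‹_›
  have := quasiIso_homComplexMapRight Q (tensorMap (𝟙 Q) f) this
  rw [← quasiIso_iff_comp_right _ (homComplexMapRight Q (tensorMap (𝟙 Q) f)),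
    toHomTensor_naturality, quasiIso_iff_comp_left]

theorem quasiIso_tensorHomEval_iff_of_quasiIso {X Y : Cplx R} (f : X ⟶ Y) [QuasiIso f] {Q : Cplx R}
    (hQ : ∀ n, Projective (Q.X n)) {b : ℤ} [Q.IsStrictlyLE b] :
    QuasiIso (tensorHomEval Q X) ↔ QuasiIso (tensorHomEval Q Y) := by
  have := CochainComplex.isKProjective_of_projective Q b
  have := quasiIso_homComplexMapRight Q f ‹_›
  have := quasiIso_tensorMap_id_left (fun n ↦ Module.Flat.of_projective (M := Q.X n)) b _ this
  rw [← quasiIso_iff_comp_left (tensorMap (𝟙 Q) (homComplexMapRight Q f)),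
    tensorHomEval_naturality, quasiIso_iff_comp_right]

theorem quasiIso_toHomTensor_iff {Q P J : Cplx R} [Q.IsKProjective] (v : P ⟶ homComplex Q J)
    (hv : QuasiIso (untranspose v)) : QuasiIso (toHomTensor Q P) ↔ QuasiIso v := by
  have := quasiIso_homComplexMapRight Q (untranspose v) hv
  rw [← quasiIso_iff_comp_right _ (homComplexMapRight Q (untranspose v))]
  exact iff_of_eq (congrArg (QuasiIso ·) (transpose_untranspose v))

theorem quasiIso_tensorHomEval_iff {Q P J : Cplx R} (hQ : ∀ n, Projective (Q.X n)) {b : ℤ}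
    [Q.IsStrictlyLE b] (v : P ⟶ homComplex Q J) (hv : QuasiIso v) :
    QuasiIso (tensorHomEval Q J) ↔ QuasiIso (untranspose v) := by
  have := quasiIso_tensorMap_id_left (fun n ↦ Module.Flat.of_projective (M := Q.X n)) b v hv
  rw [untranspose, quasiIso_iff_comp_left]

section Resolution

variable {P I J Q : Cplx R} (u : P ⟶ homComplex I J) (f : Q ⟶ I) [QuasiIso f]

theorem quasiIso_comp_homComplexMapLeft_iff [J.IsKInjective] :
    QuasiIso (u ≫ homComplexMapLeft f J) ↔ QuasiIso u := by
  have := quasiIso_homComplexMapLeft f J ‹_›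
  exact quasiIso_iff_comp_right _ _

theorem quasiIso_untranspose_comp_homComplexMapLeft_iff [P.IsKProjective] :
    QuasiIso (untranspose (u ≫ homComplexMapLeft f J)) ↔ QuasiIso (untranspose u) := by
  have := quasiIso_tensorMap_id_right f ‹_› P
  rw [untranspose_comp_homComplexMapLeft, quasiIso_iff_comp_left]

end Resolution

end Adjunction

section Classes

variable {R : Type u} [CommRing R]

theorem ProjRes.isKProjective {X : Cplx R} (r : ProjRes X) : r.P.IsKProjective := by
  obtain ⟨b, _⟩ := r.bounded
  have := r.projective
  exact CochainComplex.isKProjective_of_projective r.P b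

theorem InjRes.isKInjective {X : Cplx R} (i : InjRes X) : i.I.IsKInjective := by
  obtain ⟨a, _⟩ := i.bounded
  have := i.injective
  exact CochainComplex.isKInjective_of_injective i.I a

theorem AuslanderClass.exists_isPerfect {D X : Cplx R} (hX : AuslanderClass D X) (i : InjRes D)
    (r : ProjRes X) : ∃ (B : Cplx R) (j : InjRes B) (u : r.P ⟶ homComplex i.I j.I),
      HomologicallyBounded B ∧ IsPerfect u := by
  obtain ⟨-, s, hs, (h : QuasiIso (toHomTensor s.P X))⟩ := hX
  have := i.quasiIso
  have := r.quasiIso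
  have := s.quasiIso
  have := r.isKProjective
  have := s.isKProjective
  obtain ⟨b, _⟩ := s.bounded
  let f : s.P ⟶ i.I := s.π ≫ i.ι
  have hB : HomologicallyBounded (tensorComplex i.I r.P) := by
    have := quasiIso_tensorMap_id_left
      (fun n ↦ have := s.projective n; Module.Flat.of_projective (M := s.P.X n)) b r.π ‹_›
    have := quasiIso_tensorMap_id_right f inferInstance r.P
    rwa [← homologicallyBounded_iff_of_quasiIso (tensorMap f (𝟙 r.P)),
      homologicallyBounded_iff_of_quasiIso (tensorMap (𝟙 s.P) r.π)]
  obtain ⟨j⟩ := hB.nonempty_injRes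
  have := j.isKInjective
  have hu : QuasiIso (untranspose (transpose j.ι)) := by
    rw [untranspose_transpose]
    exact j.quasiIso
  refine ⟨_, j, transpose j.ι, hB, ?_, hu⟩
  rwa [← quasiIso_comp_homComplexMapLeft_iff _ f, ← quasiIso_toHomTensor_iff,
    quasiIso_toHomTensor_iff_of_quasiIso r.π s.projective (b := b)]
  rwa [quasiIso_untranspose_comp_homComplexMapLeft_iff]

theorem BassClass.exists_isPerfect {D Y : Cplx R} (hY : BassClass D Y) (i : InjRes D)
    (j : InjRes Y) : ∃ (A : Cplx R) (r : ProjRes A) (u : r.P ⟶ homComplex i.I j.I),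
      HomologicallyBounded A ∧ IsPerfect u := by
  obtain ⟨-, s, hs, (h : QuasiIso (tensorHomEval s.P Y))⟩ := hY
  have := i.quasiIso
  have := j.quasiIso
  have := s.quasiIso
  have := j.isKInjective
  have := s.isKProjective
  obtain ⟨b, _⟩ := s.bounded
  let f : s.P ⟶ i.I := s.π ≫ i.ι
  have hA : HomologicallyBounded (homComplex i.I j.I) := by
    have := quasiIso_homComplexMapRight s.P j.ι inferInstance
    have := quasiIso_homComplexMapLeft f j.I inferInstance
    rwa [homologicallyBounded_iff_of_quasiIso (homComplexMapLeft f j.I),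
      ← homologicallyBounded_iff_of_quasiIso (homComplexMapRight s.P j.ι)]
  obtain ⟨r⟩ := hA.nonempty_projRes
  have := r.isKProjective
  refine ⟨_, r, r.π, hA, r.quasiIso, ?_⟩
  rwa [← quasiIso_untranspose_comp_homComplexMapLeft_iff _ f,
    ← quasiIso_tensorHomEval_iff s.projective (b := b),
    ← quasiIso_tensorHomEval_iff_of_quasiIso j.ι s.projective (b := b)]
  exact (quasiIso_comp_homComplexMapLeft_iff _ f).2 r.quasiIso

variable {P I J : Cplx R} [P.IsKProjective] [J.IsKInjective] {u : P ⟶ homComplex I J}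

theorem IsPerfect.auslanderClass (hu : IsPerfect u) (hP : HomologicallyBounded P)
    (hI : HomologicallyBounded I) (hJ : HomologicallyBounded J) : AuslanderClass I P := by
  obtain ⟨r⟩ := hI.nonempty_projRes
  have := r.quasiIso
  have := r.isKProjective
  have h := (quasiIso_untranspose_comp_homComplexMapLeft_iff u r.π).2 hu.quasiIso_untranspose
  refine ⟨hP, r, (homologicallyBounded_iff_of_quasiIso
    (untranspose (u ≫ homComplexMapLeft r.π J))).2 hJ, ?_⟩
  exact (quasiIso_toHomTensor_iff _ h).2
    ((quasiIso_comp_homComplexMapLeft_iff u r.π).2 hu.quasiIso)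

theorem IsPerfect.bassClass (hu : IsPerfect u) (hP : HomologicallyBounded P)
    (hI : HomologicallyBounded I) (hJ : HomologicallyBounded J) : BassClass I J := by
  obtain ⟨r⟩ := hI.nonempty_projRes
  have := r.quasiIso
  obtain ⟨b, _⟩ := r.bounded
  have h := (quasiIso_comp_homComplexMapLeft_iff u r.π).2 hu.quasiIso
  refine ⟨hJ, r, (homologicallyBounded_iff_of_quasiIso (u ≫ homComplexMapLeft r.π J)).1 hP, ?_⟩
  exact (quasiIso_tensorHomEval_iff r.projective (b := b) _ h).2
    ((quasiIso_untranspose_comp_homComplexMapLeft_iff u r.π).2 hu.quasiIso_untranspose)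

end Classes

section ResolutionsChangeOfRings

variable {R S : Type u} [CommRing R] [CommRing S] (φ : R →+* S)

theorem injective_coext_X {I : Cplx R} (hI : ∀ n, Injective (I.X n)) (n : ℤ) :
    Injective (((coext φ).obj I).X n) :=
  have := hI n
  Injective.injective_of_adjoint (ModuleCat.restrictCoextendScalarsAdj φ) (I.X n)

theorem projective_ext_X {P : Cplx R} (hP : ∀ n, Projective (P.X n)) (n : ℤ) :
    Projective (((ext φ).obj P).X n) :=
  (ModuleCat.extendRestrictScalarsAdj φ).map_projective (P.X n) (hP n)

theorem InjRes.isKInjective_coext {X : Cplx R} (j : InjRes X) :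
    ((coext φ).obj j.I).IsKInjective := by
  obtain ⟨a, _⟩ := j.bounded
  have (n : ℤ) := injective_coext_X φ j.injective n
  have : ((coext φ).obj j.I).IsStrictlyGE a := inferInstance
  exact CochainComplex.isKInjective_of_injective _ a

theorem ProjRes.isKProjective_ext {X : Cplx R} (r : ProjRes X) :
    ((ext φ).obj r.P).IsKProjective := by
  obtain ⟨b, _⟩ := r.bounded
  have (n : ℤ) := projective_ext_X φ r.projective n
  have : ((ext φ).obj r.P).IsStrictlyLE b := inferInstance
  exact CochainComplex.isKProjective_of_projective _ b

theorem exactAt_res_iff (X : Cplx S) (n : ℤ) : ((res φ).obj X).ExactAt n ↔ X.ExactAt n := by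
  rw [exactAt_iff_apply _ (n - 1) n (n + 1) (by lia) rfl,
    exactAt_iff_apply _ (n - 1) n (n + 1) (by lia) rfl]
  exact Iff.rfl

theorem homologicallyBounded_res_iff (X : Cplx S) :
    HomologicallyBounded ((res φ).obj X) ↔ HomologicallyBounded X := by
  simp only [homologicallyBounded_iff, HomologyEventually,
    ← HomologicalComplex.exactAt_iff_isZero_homology, exactAt_res_iff]

theorem finite_homology_of_res {X : Cplx S} {n : ℤ}
    (h : Module.Finite R (((res φ).obj X).homology n)) : Module.Finite S (X.homology n) := by
  let e : ((res φ).obj X).homology n ≅ (ModuleCat.restrictScalars φ).obj (X.homology n) :=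
    (X.sc n).mapHomologyIso (ModuleCat.restrictScalars φ)
  let _ : Algebra R S := φ.toAlgebra
  let _ : Module R (X.homology n) := ((ModuleCat.restrictScalars φ).obj (X.homology n)).isModule
  have : IsScalarTower R S (X.homology n) := ⟨fun r s x ↦ mul_smul (φ r) s x⟩
  have : Module.Finite R (X.homology n) := Module.Finite.equiv e.toLinearEquiv
  exact Module.Finite.of_restrictScalars_finite R S _

variable [IsNoetherianRing R] [Module.Finite R (target φ)]

theorem InjRes.homologicallyBounded_coext {m : ℕ} [HasProjectiveDimensionLT (target φ) m]
    {X : Cplx R} (j : InjRes X) (hX : HomologicallyBounded X) :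
    HomologicallyBounded ((coext φ).obj j.I) := by
  have := j.quasiIso
  have h := (homologicallyBounded_iff_of_quasiIso j.ι).1 hX
  exact (homologicallyBounded_res_iff φ _).1
    ((homologicallyBounded_iff_of_quasiIso (fromResCoext φ j.I)).2
      (isThick_homologicallyBounded.prop_homModFunctor j.injective h (target φ) (m := m)))

theorem ProjRes.homologicallyBounded_ext {m : ℕ} [HasProjectiveDimensionLT (target φ) m]
    {X : Cplx R} (r : ProjRes X) (hX : HomologicallyBounded X) :
    HomologicallyBounded ((ext φ).obj r.P) := by
  have := r.quasiIso
  have := r.projective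
  have h := (homologicallyBounded_iff_of_quasiIso r.π).2 hX
  exact (homologicallyBounded_res_iff φ _).1
    ((homologicallyBounded_iff_of_quasiIso (toResExt φ r.P)).1
      (isThick_homologicallyBounded.prop_tensorModFunctor
        (fun n ↦ Module.Flat.of_projective (M := r.P.X n)) h (target φ) (m := m)))

theorem finite_homology_coext {m : ℕ} [HasProjectiveDimensionLT (target φ) m] {I : Cplx R}
    (hI : ∀ n, Injective (I.X n)) (h : ∀ n, Module.Finite R (I.homology n)) (n : ℤ) :
    Module.Finite S (((coext φ).obj I).homology n) := by
  have := isThick_finite_homology.prop_homModFunctor hI h (target φ) (m := m) n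
  exact finite_homology_of_res φ (Module.Finite.equiv
    (asIso (HomologicalComplex.homologyMap (fromResCoext φ I) n)).toLinearEquiv.symm)

end ResolutionsChangeOfRings

section Homothety

variable {R : Type u} [CommRing R]

/-- The ring, as a complex concentrated in degree `0`. -/
abbrev unitComplex (R : Type u) [CommRing R] : Cplx R :=
  (HomologicalComplex.single (ModuleCat.{u} R) (ComplexShape.up ℤ) 0).obj (ModuleCat.of R R)

/-- The identification of the ring with the degree `0` part of `unitComplex R`. -/
def unitEquiv (R : Type u) [CommRing R] : R ≃ₗ[R] (unitComplex R).X 0 :=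
  (HomologicalComplex.singleObjXSelf (ComplexShape.up ℤ) 0 (ModuleCat.of R R)).symm.toLinearEquiv

theorem mkHomFromSingle_unitEquiv {K : Cplx R} (f : ModuleCat.of R R ⟶ K.X 0)
    (hf : ∀ k, (ComplexShape.up ℤ).Rel 0 k → f ≫ K.d 0 k = 0) (r : R) :
    (HomologicalComplex.mkHomFromSingle f hf).f 0 (unitEquiv R r) = f r := by
  rw [HomologicalComplex.mkHomFromSingle_f, ModuleCat.comp_apply]
  exact congrArg f ((unitEquiv R).symm_apply_apply r)

theorem unitComplex_hom_ext {K : Cplx R} {f g : unitComplex R ⟶ K}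
    (h : f.f 0 (unitEquiv R 1) = g.f 0 (unitEquiv R 1)) : f = g :=
  HomologicalComplex.from_single_hom_ext (ModuleCat.hom_ext
    ((LinearEquiv.eq_comp_toLinearMap_iff (e₁₂ := unitEquiv R) _ _).1 (LinearMap.ext_ring h)))

theorem homothety_unitEquiv_one {P D : Cplx R} (π : P ⟶ D) :
    (homothety π).f 0 (unitEquiv R 1) = Cochain.ofHom π :=
  (mkHomFromSingle_unitEquiv _ _ 1).trans (one_smul R (Cochain.ofHom π))

theorem homothety_comp_homComplexMapRight {P D I : Cplx R} (π : P ⟶ D) (ι : D ⟶ I) :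
    homothety π ≫ homComplexMapRight P ι = homothety (π ≫ ι) := by
  refine unitComplex_hom_ext ?_
  rw [homothety_unitEquiv_one, HomologicalComplex.comp_f, ModuleCat.comp_apply,
    homothety_unitEquiv_one]
  exact (Cochain.ofHom_comp π ι).symm

theorem homothety_comp_homComplexMapLeft {P D I : Cplx R} (π : P ⟶ D) (ι : D ⟶ I) :
    homothety ι ≫ homComplexMapLeft π I = homothety (π ≫ ι) := by
  refine unitComplex_hom_ext ?_
  rw [homothety_unitEquiv_one, HomologicalComplex.comp_f, ModuleCat.comp_apply,
    homothety_unitEquiv_one]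
  exact (Cochain.ofHom_comp π ι).symm

theorem IsDualizing.quasiIso_homothety {D : Cplx R} (hD : IsDualizing D) (i : InjRes D) :
    QuasiIso (AuslanderBass.homothety (𝟙 i.I)) := by
  obtain ⟨r, hr⟩ := hD.homothety
  have := i.quasiIso
  have := r.quasiIso
  have := i.isKInjective
  have := r.isKProjective
  have := quasiIso_homComplexMapRight r.P i.ι inferInstance
  have := quasiIso_homComplexMapLeft (r.π ≫ i.ι) i.I inferInstance
  rw [← quasiIso_iff_comp_right _ (homComplexMapLeft (r.π ≫ i.ι) i.I),
    homothety_comp_homComplexMapLeft, Category.comp_id, ← homothety_comp_homComplexMapRight]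
  infer_instance

theorem flat_unitComplex (n : ℤ) : Module.Flat R ((unitComplex R).X n) := by
  by_cases hn : n = 0
  · subst hn
    exact Module.Flat.of_linearEquiv (unitEquiv R).symm
  · have := ModuleCat.subsingleton_of_isZero
      (HomologicalComplex.isZero_single_obj_X (ComplexShape.up ℤ) 0 (ModuleCat.of R R) n hn)
    infer_instance

variable {S : Type u} [CommRing S] (φ : R →+* S)

/-- The isomorphism `S ≅ S ⊗_R R` of modules. -/
def selfIsoExtendScalars :
    ModuleCat.of S S ≅ (ModuleCat.extendScalars.{u, u, u} φ).obj (ModuleCat.of R R) :=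
  have e : ModuleCat.of S S ≃ₗ[S] (ModuleCat.extendScalars.{u, u, u} φ).obj (ModuleCat.of R R) :=
    { (TensorProduct.rid R (target φ)).symm.toAddEquiv with
      map_smul' _ _ := rfl }
  e.toModuleIso

/-- The isomorphism `S ≅ S ⊗_R R` of complexes. -/
def unitComplexIsoExt : unitComplex S ≅ (ext φ).obj (unitComplex R) :=
  (HomologicalComplex.single _ _ 0).mapIso (selfIsoExtendScalars φ) ≪≫
    ((HomologicalComplex.singleMapHomologicalComplex (ModuleCat.extendScalars φ) _ 0).app _).symm

theorem unitComplexIsoExt_hom_unitEquiv_one :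
    (unitComplexIsoExt φ).hom.f 0 (unitEquiv S 1) = extTmul 1 (unitEquiv R 1) := by
  have h₁ : (HomologicalComplex.singleObjXSelf (.up ℤ) 0 _).inv ≫
      ((HomologicalComplex.single _ (.up ℤ) 0).map (selfIsoExtendScalars φ).hom).f 0 =
        (selfIsoExtendScalars φ).hom ≫ (HomologicalComplex.singleObjXSelf (.up ℤ) 0 _).inv := by
    rw [HomologicalComplex.single_map_f_self, Iso.inv_hom_id_assoc]
  have h₂ := (Iso.inv_comp_eq _).2 (HomologicalComplex.singleMapHomologicalComplex_inv_app_self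
    (ModuleCat.extendScalars.{u, u, u} φ) (.up ℤ) 0 (ModuleCat.of R R))
  let e := HomologicalComplex.singleMapHomologicalComplex
    (ModuleCat.extendScalars.{u, u, u} φ) (.up ℤ) 0
  exact (congrArg ((e.inv.app _).f 0) (congrArg (fun f ↦ f (1 : S)) h₁)).trans
    (congrArg (fun f ↦ f ((selfIsoExtendScalars φ).hom (1 : S))) h₂)

theorem unitComplexIsoExt_hom_comp_cobasePairing (I : Cplx R) :
    (unitComplexIsoExt φ).hom ≫ cobasePairing φ (homothety (𝟙 I)) =
      homothety (𝟙 ((coext φ).obj I)) := by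
  refine unitComplex_hom_ext ?_
  rw [homothety_unitEquiv_one, HomologicalComplex.comp_f, ModuleCat.comp_apply,
    unitComplexIsoExt_hom_unitEquiv_one, cobasePairing_one_extTmul, homothety_unitEquiv_one]
  exact (Cochain.map_ofHom _ _ (𝟙 I) (ModuleCat.coextendScalars φ)).trans
    (congrArg Cochain.ofHom ((coext φ).map_id I))

theorem quasiIso_homothety_id_coext [IsNoetherianRing R] {I : Cplx R} [I.IsKInjective]
    (hI : ∀ n, Injective (I.X n)) [QuasiIso (homothety (𝟙 I))] [Module.Finite R (target φ)] {m : ℕ}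
    [HasProjectiveDimensionLT (target φ) m] :
    QuasiIso (homothety (𝟙 ((coext φ).obj I))) := by
  have := quasiIso_cobasePairing φ (homothety (𝟙 I)) flat_unitComplex hI hI (m := m)
  rw [← unitComplexIsoExt_hom_comp_cobasePairing]
  infer_instance

end Homothety

section Dualizing

variable {R S : Type u} [CommRing R] [CommRing S] (φ : R →+* S)

theorem finiteInjectiveDimension_coext {D : Cplx R} (hD : FiniteInjectiveDimension D)
    (i : InjRes D) : FiniteInjectiveDimension ((coext φ).obj i.I) := by
  obtain ⟨U, hU, ⟨a, b, _, _⟩, Z, f, g, _, _⟩ := hD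
  have := i.quasiIso
  have := i.isKInjective
  have := CochainComplex.isKInjective_of_injective U a
  obtain ⟨e⟩ := nonempty_homotopyEquiv_of_isKInjective (f ≫ i.ι) g
  have : QuasiIso ((ModuleCat.coextendScalars.{u, u, u} φ).mapHomotopyEquiv e).hom := inferInstance
  exact ⟨(coext φ).obj U, injective_coext_X φ hU, ⟨a, b, inferInstance, inferInstance⟩,
    (coext φ).obj i.I, 𝟙 _, ((ModuleCat.coextendScalars φ).mapHomotopyEquiv e).hom,
    inferInstance, inferInstance⟩

theorem isDualizing_coext [IsNoetherianRing R] [Module.Finite R (target φ)] {m : ℕ}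
    [HasProjectiveDimensionLT (target φ) m] {D : Cplx R} (hD : IsDualizing D) (i : InjRes D) :
    IsDualizing ((coext φ).obj i.I) := by
  have := i.quasiIso
  have := i.isKInjective
  have := i.isKInjective_coext φ
  have hb := i.homologicallyBounded_coext φ (m := m) hD.bounded
  refine ⟨hb, finite_homology_coext φ (m := m) i.injective fun n ↦ ?_,
    finiteInjectiveDimension_coext φ hD.injective i, ?_⟩
  · have := hD.finite n
    exact Module.Finite.equiv (asIso (HomologicalComplex.homologyMap i.ι n)).toLinearEquiv
  · obtain ⟨r⟩ := hb.nonempty_projRes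
    have := hD.quasiIso_homothety i
    have := quasiIso_homothety_id_coext φ (m := m) i.injective
    have := quasiIso_homComplexMapLeft r.π ((coext φ).obj i.I) r.quasiIso
    refine ⟨r, ?_⟩
    rw [← Category.comp_id r.π, ← homothety_comp_homComplexMapLeft]
    infer_instance

end Dualizing

section FiniteBaseChange

variable {R S : Type u} [CommRing R] [IsNoetherianRing R] [CommRing S] (φ : R →+* S)
  [Module.Finite R (target φ)] {D X : Cplx R}

theorem auslanderClass_ext {m : ℕ} [HasProjectiveDimensionLT (target φ) m]
    (hX : AuslanderClass D X) (hD : HomologicallyBounded D) (i : InjRes D) (r : ProjRes X) :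
    AuslanderClass ((coext φ).obj i.I) ((ext φ).obj r.P) := by
  obtain ⟨B, j, u, hB, hu⟩ := hX.exists_isPerfect i r
  have := r.isKProjective
  have := j.isKInjective
  have := r.isKProjective_ext φ
  have := j.isKInjective_coext φ
  exact (isPerfect_cobasePairing φ hu r.projective i.injective j.injective (m := m)).auslanderClass
    (r.homologicallyBounded_ext φ (m := m) hX.1) (i.homologicallyBounded_coext φ (m := m) hD)
    (j.homologicallyBounded_coext φ (m := m) hB)

theorem bassClass_coext {m : ℕ} [HasProjectiveDimensionLT (target φ) m] (hX : BassClass D X)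
    (hD : HomologicallyBounded D) (i : InjRes D) (j : InjRes X) :
    BassClass ((coext φ).obj i.I) ((coext φ).obj j.I) := by
  obtain ⟨A, r, u, hA, hu⟩ := hX.exists_isPerfect i j
  have := r.isKProjective
  have := j.isKInjective
  have := r.isKProjective_ext φ
  have := j.isKInjective_coext φ
  exact (isPerfect_cobasePairing φ hu r.projective i.injective j.injective (m := m)).bassClass
    (r.homologicallyBounded_ext φ (m := m) hA) (i.homologicallyBounded_coext φ (m := m) hD)
    (j.homologicallyBounded_coext φ (m := m) hX.1)

end FiniteBaseChange

theorem proposition2p3_general {R S : Type u} [CommRing R] [IsNoetherianRing R] [CommRing S]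
    (φ : R →+* S) (hφ : φ.Finite) (hfd : FiniteFlatDimension (targetComplex φ)) (D : Cplx R)
    (hD : IsDualizing D) :
    IsDualizing (rCobaseChange φ D hD.bounded) ∧
    ∀ (X : Cplx R) (hX : HomologicallyBounded X),
      (AuslanderClass D X → AuslanderClass (rCobaseChange φ D hD.bounded) (lBaseChange φ X hX)) ∧
      (BassClass D X → BassClass (rCobaseChange φ D hD.bounded) (rCobaseChange φ X hX)) := by
  have : Module.Finite R (target φ) := hφ
  obtain ⟨m, _⟩ : ∃ m, HasProjectiveDimensionLT (target φ) m :=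
    hfd.exists_hasProjectiveDimensionLT
  let i := hD.bounded.nonempty_injRes.some
  exact ⟨isDualizing_coext φ hD i (m := m), fun X hX ↦
    ⟨fun h ↦ auslanderClass_ext φ h hD.bounded i hX.nonempty_projRes.some (m := m),
      fun h ↦ bassClass_coext φ h hD.bounded i hX.nonempty_injRes.some (m := m)⟩⟩

end

end AuslanderBass

theorem proposition2p3 {R S : Type u} [CommRing R] [CommRing S]
    [IsNoetherianRing R] [IsNoetherianRing S] [IsLocalRing R] [IsLocalRing S]
    (φ : R →+* S) [IsLocalHom φ] (hφ : φ.Finite)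
    (hfd : AuslanderBass.FiniteFlatDimension (AuslanderBass.targetComplex φ))
    (D : AuslanderBass.Cplx R) (hD : AuslanderBass.IsDualizing D) :
    AuslanderBass.IsDualizing (AuslanderBass.rCobaseChange φ D hD.bounded) ∧
    ∀ (X : AuslanderBass.Cplx R) (hX : AuslanderBass.HomologicallyBounded X),
      (AuslanderBass.AuslanderClass D X →
        AuslanderBass.AuslanderClass (AuslanderBass.rCobaseChange φ D hD.bounded)
          (AuslanderBass.lBaseChange φ X hX)) ∧
      (AuslanderBass.BassClass D X →
        AuslanderBass.BassClass (AuslanderBass.rCobaseChange φ D hD.bounded)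
          (AuslanderBass.rCobaseChange φ X hX)) :=
  AuslanderBass.proposition2p3_general φ hφ hfd D hD
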